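/- Let $d\ge 1$ and write $(\Delta_h f)(y)=f(y+h)-f(y)$, $\Delta_h^m=(\Delta_h)^m$. For $s>0$ and $p\in[1,\infty]$ put \[ \|f\|_{B^s_{p,\infty}}=\|f\|_{L^p(\mathbb R^d)}+\sup_{0<|h|<1}|h|^{-s}\|\Delta_h^{\lfloor s\rfloor+1}f\|_{L^p(\mathbb R^d)}, \] let $B^s_{p,\infty}$ be the closure of the Schwartz space in this norm, and let $\mathscr C^\alpha_b=B^\alpha_{\infty,\infty}$ (its elements being identified with their continuous representatives). Let $a_0>0$, $\theta>0$, $a\in(0,a_0)$ and $\delta>0$. Then there is an integer $m_0$, depending only on $d,a_0,\theta,a,\delta$, such that for every integer $m\ge m_0$ there is a constant $c>0$, depending only on $d,a_0,\theta,a,\delta,m$, with the following property. Let $b\in L^\infty(\mathbb R^d;\mathbb R^d)$, let $\sigma:\mathbb R^d\to\mathbb R^{d\times d'}$ be bounded and Hölder continuous of some exponent $\beta\in(0,1)$, let $x\in\mathbb R^d$, and let $X$ be a solution, on some filtered probability space with a $d'$-dimensional Brownian motion $B$, of \[ dX_t=b(X_t)\,dt+\sigma(X_t)\,dB_t,\qquad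 X_0=x . \] Let $t>0$ and $K_0\ge 1$ be such that \[ \mathbb E[(\Delta_h^m\phi)(X_t)]\le K_0^{\frac{\alpha}{\theta}}\Bigl(\epsilon^{\frac{\alpha}{\theta}(1+a_0)}+\bigl(|h|/\epsilon^{1/\theta}\bigr)^m\Bigr)\|\phi\|_{\mathscr C^\alpha_b} \] for every $\epsilon$ with $0<\epsilon<1$ and $\epsilon\le t/2$, every $\alpha\in(0,1)$, every $\phi\in\mathscr C^\alpha_b$ and every $h\in\mathbb R^d$ with $|h|\le 1$. Then $X_t$ has a density $p_x(t)$ with respect to Lebesgue measure, $p_x(t)\in B^a_{1,\infty}$, and \[ \|p_x(t)\|_{B^a_{1,\infty}}\le c\,K_0^{\frac{a}{\theta a_0}+\delta}\,(1\wedge t)^{-\frac{1+a_0}{\theta a_0}a-\delta}. \] In particular $c$ does not depend on $x$, $t$, $K_0$ or the coefficients. -/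

import Mathlib

open MeasureTheory ProbabilityTheory
open scoped NNReal ENNReal SchwartzMap

noncomputable section

/-- Euclidean space `ℝ^d`. -/
abbrev Euc (d : ℕ) : Type := EuclideanSpace ℝ (Fin d)

/-! ### Besov spaces `B^s_{p,∞}(ℝ^d)` through differences -/

/-- The seminorm `[f]_{B^s_{p,∞}} = sup_{0 < |h| < 1} ‖Δ_h^n f‖_{L^p} / |h|^s`, computed with the
smallest integer `n > s`. (The supremum over `h` equals the essential supremum, because
`h ↦ ‖Δ_h^n f‖_{L^p}` is lower semicontinuous.) -/
def besovSeminorm {d : ℕ} (s : ℝ) (p : ℝ≥0∞) (f : Euc d → ℝ) : ℝ≥0∞ :=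
  ⨆ (h : Euc d) (_ : 0 < ‖h‖ ∧ ‖h‖ < 1),
    eLpNorm ((fwdDiff h)^[⌊s⌋₊ + 1] f) p volume / ENNReal.ofReal (‖h‖ ^ s)

/-- The norm `‖f‖_{B^s_{p,∞}} = ‖f‖_{L^p} + [f]_{B^s_{p,∞}}`, for `s > 0`. -/
def besovNorm {d : ℕ} (s : ℝ) (p : ℝ≥0∞) (f : Euc d → ℝ) : ℝ≥0∞ :=
  eLpNorm f p volume + besovSeminorm s p f

/-- Membership in the (separable) space `B^s_{p,∞}(ℝ^d)`: the closure of the Schwartz space with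
respect to the norm `‖·‖_{B^s_{p,∞}}`. -/
def MemBesov {d : ℕ} (s : ℝ) (p : ℝ≥0∞) (f : Euc d → ℝ) : Prop :=
  ∀ η : ℝ≥0∞, 0 < η → ∃ g : 𝓢(Euc d, ℝ), besovNorm s p (fun y => f y - g y) < η

/-- The Zygmund space `𝒞^α_b(ℝ^d) = B^α_{∞,∞}(ℝ^d)`; its elements are identified with their
continuous representatives. For `α ∈ (0,1)` the norm `besovNorm α ⊤` is the Hölder norm
`sup |φ| + sup_{0 < |h| < 1, y} |φ (y + h) - φ y| / |h|^α`. -/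
def MemZygmund {d : ℕ} (α : ℝ) (φ : Euc d → ℝ) : Prop :=
  Continuous φ ∧ MemBesov α ⊤ φ

/-! ### The stochastic differential equation -/

/-- `σ ∈ C^β_b(ℝ^d; ℝ^{d×d'})`: bounded and Hölder continuous of exponent `β`. -/
def IsBoundedHolder {d d' : ℕ} (β : ℝ) (σ : Euc d → Matrix (Fin d) (Fin d') ℝ) : Prop :=
  ∃ C : ℝ, (∀ y i j, |σ y i j| ≤ C) ∧ ∀ y z i j, |σ y i j - σ z i j| ≤ C * ‖y - z‖ ^ β

/-- `B` is a standard `k`-dimensional Brownian motion with respect to the filtration `ℱ`. -/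
structure IsBrownianMotion {Ω : Type*} {mΩ : MeasurableSpace Ω} {k : ℕ}
    (ℱ : Filtration ℝ≥0 mΩ) (P : Measure Ω) (B : ℝ≥0 → Ω → Euc k) : Prop where
  adapted : ∀ t, Measurable[ℱ t] (B t)
  zero : ∀ᵐ ω ∂P, B 0 ω = 0
  continuous : ∀ᵐ ω ∂P, Continuous fun t => B t ω
  indep : ∀ s t, s ≤ t →
    Indep (MeasurableSpace.comap (fun ω => B t ω - B s ω) inferInstance) (ℱ s) P
  law : ∀ s t, s ≤ t →
    P.map (fun ω => B t ω - B s ω) =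
      (stdGaussian (Euc k)).map (fun z => Real.sqrt ((t : ℝ) - s) • z)

/-- A simple matrix-valued integrand `∑_{k<n} ξ_k 1_{(t_k, t_{k+1}]}`, with `ξ_k` bounded and
`ℱ_{t_k}`-measurable. -/
structure SimpleIntegrand {Ω : Type*} {mΩ : MeasurableSpace Ω} (ℱ : Filtration ℝ≥0 mΩ)
    (d d' : ℕ) where
  n : ℕ
  time : ℕ → ℝ≥0
  mono : Monotone time
  val : ℕ → Ω → Matrix (Fin d) (Fin d') ℝ
  measurable : ∀ k i j, Measurable[ℱ (time k)] fun ω => val k ω i j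
  bounded : ∃ C : ℝ, ∀ k ω i j, |val k ω i j| ≤ C

namespace SimpleIntegrand

variable {Ω : Type*} {mΩ : MeasurableSpace Ω} {ℱ : Filtration ℝ≥0 mΩ} {d d' : ℕ}

/-- The value at time `s` of a simple integrand. -/
def process (S : SimpleIntegrand ℱ d d') (s : ℝ≥0) (ω : Ω) : Matrix (Fin d) (Fin d') ℝ :=
  ∑ k ∈ Finset.range S.n, if S.time k < s ∧ s ≤ S.time (k + 1) then S.val k ω else 0

/-- The stochastic integral `∑_k ξ_k (B_{t_{k+1} ∧ t} - B_{t_k ∧ t})` of a simple integrand. -/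
def integral (S : SimpleIntegrand ℱ d d') (B : ℝ≥0 → Ω → Euc d') (t : ℝ≥0) (ω : Ω) : Euc d :=
  ∑ k ∈ Finset.range S.n,
    Matrix.toLpLin 2 2 (S.val k ω) (B (min (S.time (k + 1)) t) ω - B (min (S.time k) t) ω)

end SimpleIntegrand

/-- `J` is the Itô integral `∫_0^t H_s dB_s`: there are simple integrands `S_n` with
`E ∫_0^t |S_n(s) - H_s|² ds → 0` (Hilbert–Schmidt norm) and `E |∫_0^t S_n dB - J|² → 0`. -/
def IsItoIntegral {Ω : Type*} {mΩ : MeasurableSpace Ω} {d d' : ℕ} (ℱ : Filtration ℝ≥0 mΩ)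
    (P : Measure Ω) (B : ℝ≥0 → Ω → Euc d') (H : ℝ≥0 → Ω → Matrix (Fin d) (Fin d') ℝ)
    (t : ℝ≥0) (J : Ω → Euc d) : Prop :=
  ∃ S : ℕ → SimpleIntegrand ℱ d d',
    Filter.Tendsto (fun n => ∫⁻ ω, (∫⁻ s in Set.Icc (0 : ℝ) t,
        ENNReal.ofReal
          (∑ i, ∑ j, ((S n).process s.toNNReal ω i j - H s.toNNReal ω i j) ^ 2)) ∂P)
      Filter.atTop (nhds 0) ∧
    Filter.Tendsto (fun n => eLpNorm (fun ω => (S n).integral B t ω - J ω) 2 P)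
      Filter.atTop (nhds 0)

/-- `X` is a solution, driven by the `ℱ`-Brownian motion `B`, of
`dX_t = b(X_t) dt + σ(X_t) dB_t`, `X_0 = x`. -/
structure IsSDESolution {Ω : Type*} {mΩ : MeasurableSpace Ω} {d d' : ℕ}
    (b : Euc d → Euc d) (σ : Euc d → Matrix (Fin d) (Fin d') ℝ) (x : Euc d)
    (ℱ : Filtration ℝ≥0 mΩ) (P : Measure Ω) (B : ℝ≥0 → Ω → Euc d') (X : ℝ≥0 → Ω → Euc d) :
    Prop where
  brownian : IsBrownianMotion ℱ P B
  adapted : ∀ t, Measurable[ℱ t] (X t)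
  continuous : ∀ᵐ ω ∂P, Continuous fun t => X t ω
  initial : ∀ᵐ ω ∂P, X 0 ω = x
  drift_integrable : ∀ᵐ ω ∂P, ∀ t : ℝ≥0,
    IntervalIntegrable (fun s : ℝ => b (X s.toNNReal ω)) volume 0 t
  equation : ∀ t : ℝ≥0, ∃ J : Ω → Euc d,
    IsItoIntegral ℱ P B (fun s ω => σ (X s ω)) t J ∧
    ∀ᵐ ω ∂P, X t ω = x + (∫ s in (0 : ℝ)..t, b (X s.toNNReal ω)) + J ω

end

noncomputable section

open Function Set Filter
open scoped ContDiff Topology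

variable {d : ℕ}

/-! Let `μ` be the law of `X t`. Choosing `ε` as a power of `‖h‖` in the hypothesis gives a
one-parameter bound `|∫ Δ_h^m g dμ| ≤ K ‖h‖^s ‖g‖_{C^α}` (`SmoothingBound`), where `s` is as close
as desired to `α (1 + a₀)` once `m` is large. The bound gains `s` derivatives and spends `α`, so `μ`
should have a density of any regularity below `s - α`, which is almost `α a₀`. Taking `α` slightly
above `a / a₀` makes this exceed `a`, and the powers of `K₀` and `1 ∧ t` that appear are those at `α
= a / a₀` up to `δ`.

The passage from the bound to a density goes through mollification. The kernel `reprKernel`, of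
integral one, is such that averaging with it at scale `ε` differs from the identity by an average of
`m`-th differences of step at most `ε` (`kernelAvg_reprKernel_sub`). Hence averaging a function `g`
costs only `K ε^s ‖g‖_{C^α}` after integration against `μ`. Mollifying `μ` twice with this kernel,
and using that averages at scales `ε` and `ε / 2` commute, one bounds the `L¹` norm of the
differences `Δ_h^n` of the change from scale `ε` to `ε / 2` by a multiple of `K ε^(s - α - r) ‖h‖^r`
(`exists_integral_norm_fwdDiff_mollify_le`). With `r = 0` and `r = a` these changes sum
geometrically along `ε = 2^(-j)`, so the mollifications converge in `B^a_{1,∞}`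
(`exists_density_of_smoothingBound`). The limit is the density of `μ`
(`eq_withDensity_of_integral_eq`). -/

/-! ### Test functions and their differences -/

/-- Smooth functions with compact support. -/
structure IsTestFun {F : Type} [NormedAddCommGroup F] [NormedSpace ℝ F] (κ : Euc d → F) :
    Prop where
  smooth : ContDiff ℝ ∞ κ
  compact : HasCompactSupport κ

lemma fwdDiff_sub {M G : Type*} [AddCommMonoid M] [AddCommGroup G] (h : M) (f g : M → G) :
    fwdDiff h (f - g) = fwdDiff h f - fwdDiff h g := by
  ext x
  simp only [fwdDiff, Pi.sub_apply]
  abel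

lemma fwdDiff_iter_sub {M G : Type*} [AddCommMonoid M] [AddCommGroup G] (h : M) (n : ℕ)
    (f g : M → G) : (fwdDiff h)^[n] (f - g) = (fwdDiff h)^[n] f - (fwdDiff h)^[n] g := by
  induction n generalizing f g with
  | zero => rfl
  | succ n ih => simp only [iterate_succ_apply, fwdDiff_sub, ih]

lemma fwdDiff_iter_zero_fun (h : Euc d) (n : ℕ) :
    (fwdDiff h)^[n] (fun _ : Euc d => (0 : ℝ)) = fun _ => 0 := by
  induction n with
  | zero => rfl
  | succ n ih => rw [iterate_succ_apply, fwdDiff_const, ih]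

lemma integral_norm_fwdDiff_le_two_mul {F : Type*} [NormedAddCommGroup F] {f : Euc d → F} (hf : Integrable f) (h : Euc d) :
    ∫ x, ‖fwdDiff h f x‖ ≤ 2 * ∫ x, ‖f x‖ := by
  have h1 : Integrable fun x => f (x + h) := hf.comp_add_right h
  calc ∫ x, ‖fwdDiff h f x‖ ≤ ∫ x, (‖f (x + h)‖ + ‖f x‖) :=
        integral_mono (h1.sub hf).norm (h1.norm.add hf.norm) fun x => norm_sub_le _ _
    _ = 2 * ∫ x, ‖f x‖ := by
        rw [integral_add h1.norm hf.norm, integral_add_right_eq_self (fun x => ‖f x‖) h, two_mul]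

namespace IsTestFun

variable {F : Type} [NormedAddCommGroup F] [NormedSpace ℝ F] {κ κ' : Euc d → F}

lemma continuous (hκ : IsTestFun κ) : Continuous κ := hκ.smooth.continuous

lemma integrable (hκ : IsTestFun κ) : Integrable κ :=
  hκ.continuous.integrable_of_hasCompactSupport hκ.compact

lemma differentiable (hκ : IsTestFun κ) : Differentiable ℝ κ :=
  hκ.smooth.differentiable (by simp)

lemma add (hκ : IsTestFun κ) (hκ' : IsTestFun κ') : IsTestFun (κ + κ') :=
  ⟨hκ.smooth.add hκ'.smooth, hκ.compact.add hκ'.compact⟩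

lemma const_smul (hκ : IsTestFun κ) (c : ℝ) : IsTestFun (c • κ) :=
  ⟨hκ.smooth.const_smul c, hκ.compact.comp_left (g := fun x => c • x) (smul_zero c)⟩

lemma sub (hκ : IsTestFun κ) (hκ' : IsTestFun κ') : IsTestFun (κ - κ') := by
  simpa [sub_eq_add_neg] using hκ.add (hκ'.const_smul (-1))

lemma zero : IsTestFun (0 : Euc d → F) := ⟨contDiff_const, HasCompactSupport.zero⟩

lemma sum {ι : Type*} (s : Finset ι) {κ : ι → Euc d → F} (h : ∀ i ∈ s, IsTestFun (κ i)) :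
    IsTestFun (∑ i ∈ s, κ i) := by
  classical
  induction s using Finset.induction_on with
  | empty => simpa using zero
  | insert i s hi ih =>
    rw [Finset.sum_insert hi]
    exact (h i (by simp)).add (ih fun j hj => h j (by simp [hj]))

lemma translate (hκ : IsTestFun κ) (h : Euc d) : IsTestFun (fun x => κ (x + h)) :=
  ⟨hκ.smooth.comp (contDiff_id.add contDiff_const),
    hκ.compact.comp_homeomorph (Homeomorph.addRight h)⟩

lemma comp_smul (hκ : IsTestFun κ) {r : ℝ} (hr : r ≠ 0) : IsTestFun (fun x => κ (r • x)) :=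
  ⟨hκ.smooth.comp (contDiff_const_smul r),
    hκ.compact.comp_homeomorph (Homeomorph.smulOfNeZero r hr)⟩

lemma comp_neg (hκ : IsTestFun κ) : IsTestFun (fun x => κ (-x)) := by
  simpa using hκ.comp_smul (r := -1) (by norm_num)

lemma fwdDiff (hκ : IsTestFun κ) (h : Euc d) : IsTestFun (fwdDiff h κ) :=
  (hκ.translate h).sub hκ

lemma fwdDiff_iter (hκ : IsTestFun κ) (h : Euc d) (n : ℕ) :
    IsTestFun ((_root_.fwdDiff h)^[n] κ) := by
  induction n with
  | zero => exact hκ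
  | succ n ih => rw [iterate_succ_apply']; exact ih.fwdDiff h

lemma fderiv (hκ : IsTestFun κ) : IsTestFun (fderiv ℝ κ) :=
  ⟨hκ.smooth.fderiv_right (by simp), hκ.compact.fderiv ℝ⟩

lemma fderiv_fwdDiff (hκ : IsTestFun κ) (h : Euc d) :
    _root_.fderiv ℝ (_root_.fwdDiff h κ) = _root_.fwdDiff h (_root_.fderiv ℝ κ) := by
  ext1 x
  have h1 : DifferentiableAt ℝ (fun y => κ (y + h)) x := (hκ.translate h).differentiable x
  change _root_.fderiv ℝ ((fun y => κ (y + h)) - κ) x = _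
  rw [fderiv_sub h1 (hκ.differentiable x), fderiv_comp_add_right]
  rfl

lemma fderiv_fwdDiff_iter (hκ : IsTestFun κ) (h : Euc d) (n : ℕ) :
    _root_.fderiv ℝ ((_root_.fwdDiff h)^[n] κ) = (_root_.fwdDiff h)^[n] (_root_.fderiv ℝ κ) := by
  induction n with
  | zero => rfl
  | succ n ih => rw [iterate_succ_apply', iterate_succ_apply', (hκ.fwdDiff_iter h n).fderiv_fwdDiff,
      ih]

variable [CompleteSpace F]

/-- Fundamental theorem of calculus on the segment from `x` to `x + h`, then Tonelli and translation
invariance. -/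
lemma integral_norm_fwdDiff_le_norm_mul (hκ : IsTestFun κ) (h : Euc d) :
    ∫ x, ‖_root_.fwdDiff h κ x‖ ≤ ‖h‖ * ∫ x, ‖_root_.fderiv ℝ κ x‖ := by
  have hD := hκ.fderiv
  have key (x : Euc d) : ‖_root_.fwdDiff h κ x‖ₑ ≤
      ∫⁻ t in Ioc (0 : ℝ) 1, ‖h‖ₑ * ‖_root_.fderiv ℝ κ (x + t • h)‖ₑ := by
    have hd (t : ℝ) : HasDerivAt (fun t : ℝ => κ (x + t • h))
        (_root_.fderiv ℝ κ (x + t • h) h) t := by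
      have h1 : HasDerivAt (fun t : ℝ => x + t • h) h t := by
        simpa using ((hasDerivAt_id t).smul_const h).const_add x
      exact (hκ.differentiable _).hasFDerivAt.comp_hasDerivAt t h1
    have hc : Continuous fun t : ℝ => _root_.fderiv ℝ κ (x + t • h) h :=
      (hD.continuous.comp (by fun_prop)).clm_apply continuous_const
    have h2 := intervalIntegral.integral_eq_sub_of_hasDerivAt (a := 0) (b := 1)
      (fun t _ => hd t) (hc.intervalIntegrable _ _)
    have h3 : _root_.fwdDiff h κ x = ∫ t in Ioc (0 : ℝ) 1, _root_.fderiv ℝ κ (x + t • h) h := by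
      rw [← intervalIntegral.integral_of_le zero_le_one, h2]
      simp [_root_.fwdDiff]
    rw [h3]
    refine (enorm_integral_le_lintegral_enorm _).trans (lintegral_mono fun t => ?_)
    rw [mul_comm]
    exact ContinuousLinearMap.le_opENorm _ _
  have hm : Measurable (uncurry fun (x : Euc d) (t : ℝ) =>
      ‖h‖ₑ * ‖_root_.fderiv ℝ κ (x + t • h)‖ₑ) :=
    (continuous_enorm.comp (hD.continuous.comp (by fun_prop))).measurable.const_mul _
  have h4 : ∫⁻ x, ‖_root_.fwdDiff h κ x‖ₑ ≤ ‖h‖ₑ * ∫⁻ x, ‖_root_.fderiv ℝ κ x‖ₑ := by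
    calc ∫⁻ x, ‖_root_.fwdDiff h κ x‖ₑ
        ≤ ∫⁻ x, ∫⁻ t in Ioc (0 : ℝ) 1, ‖h‖ₑ * ‖_root_.fderiv ℝ κ (x + t • h)‖ₑ :=
          lintegral_mono key
      _ = ∫⁻ t in Ioc (0 : ℝ) 1, ∫⁻ x, ‖h‖ₑ * ‖_root_.fderiv ℝ κ (x + t • h)‖ₑ :=
          lintegral_lintegral_swap hm.aemeasurable
      _ = ∫⁻ t in Ioc (0 : ℝ) 1, ‖h‖ₑ * ∫⁻ x, ‖_root_.fderiv ℝ κ x‖ₑ := by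
          congr 1
          ext1 t
          rw [lintegral_add_right_eq_self (fun x => ‖h‖ₑ * ‖_root_.fderiv ℝ κ x‖ₑ) (t • h),
            lintegral_const_mul _ hD.continuous.enorm.measurable]
      _ = _ := by simp
  rw [← ofReal_integral_norm_eq_lintegral_enorm (hκ.fwdDiff h).integrable,
    ← ofReal_integral_norm_eq_lintegral_enorm hD.integrable, ← ofReal_norm,
    ← ENNReal.ofReal_mul (norm_nonneg _)] at h4
  exact (ENNReal.ofReal_le_ofReal_iff
    (mul_nonneg (norm_nonneg _) (integral_nonneg fun _ => norm_nonneg _))).1 h4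

/-- Each further difference costs a factor 2 when `‖h‖ ≥ 1`, and `‖h‖` times one derivative
otherwise. The induction hypothesis is applied to `fderiv ℝ κ` as well, so the target space `F` has
to vary in the induction. -/
lemma exists_integral_norm_fwdDiff_iter_le (n : ℕ) :
    ∀ {F : Type} [NormedAddCommGroup F] [NormedSpace ℝ F] [CompleteSpace F] {κ : Euc d → F},
      IsTestFun κ → ∃ C : ℝ, 0 ≤ C ∧ ∀ h,
        ∫ x, ‖(_root_.fwdDiff h)^[n] κ x‖ ≤ C * min 1 ‖h‖ ^ n := by
  induction n with
  | zero =>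
    intro F _ _ _ κ hκ
    exact ⟨∫ x, ‖κ x‖, integral_nonneg fun _ => norm_nonneg _, fun h => by simp⟩
  | succ n ih =>
    intro F _ _ _ κ hκ
    obtain ⟨C₁, hC₁, h₁⟩ := ih hκ
    obtain ⟨C₂, hC₂, h₂⟩ := ih hκ.fderiv
    refine ⟨max (2 * C₁) C₂, le_max_of_le_right hC₂, fun h => ?_⟩
    have hm : 0 ≤ min 1 ‖h‖ := le_min zero_le_one (norm_nonneg _)
    rw [iterate_succ_apply', pow_succ]
    rcases le_total 1 ‖h‖ with h1 | h1
    · refine (integral_norm_fwdDiff_le_two_mul (hκ.fwdDiff_iter h n).integrable h).trans ?_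
      calc _ ≤ 2 * (C₁ * min 1 ‖h‖ ^ n) := by gcongr; exact h₁ h
        _ = (2 * C₁) * (min 1 ‖h‖ ^ n * 1) := by ring
        _ ≤ _ := by
          conv_rhs => rw [min_eq_left h1]
          simp [h1]
    · refine ((hκ.fwdDiff_iter h n).integral_norm_fwdDiff_le_norm_mul h).trans ?_
      rw [hκ.fderiv_fwdDiff_iter]
      calc _ ≤ ‖h‖ * (C₂ * min 1 ‖h‖ ^ n) := by gcongr; exact h₂ h
        _ = C₂ * (min 1 ‖h‖ ^ n * min 1 ‖h‖) := by rw [min_eq_right h1]; ring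
        _ ≤ _ := by gcongr; exact le_max_right _ _

lemma exists_integral_norm_fwdDiff_fwdDiff_iter_le (hκ : IsTestFun κ) (n : ℕ) :
    ∃ C : ℝ, 0 ≤ C ∧ ∀ h k,
      ∫ x, ‖_root_.fwdDiff k ((_root_.fwdDiff h)^[n] κ) x‖ ≤ C * min 1 ‖k‖ * min 1 ‖h‖ ^ n := by
  obtain ⟨C₁, hC₁, h₁⟩ := exists_integral_norm_fwdDiff_iter_le n hκ
  obtain ⟨C₂, hC₂, h₂⟩ := exists_integral_norm_fwdDiff_iter_le n hκ.fderiv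
  refine ⟨max (2 * C₁) C₂, le_max_of_le_right hC₂, fun h k => ?_⟩
  have hm : 0 ≤ min 1 ‖h‖ := le_min zero_le_one (norm_nonneg _)
  rcases le_total 1 ‖k‖ with h1 | h1
  · refine (integral_norm_fwdDiff_le_two_mul (hκ.fwdDiff_iter h n).integrable k).trans ?_
    calc _ ≤ 2 * (C₁ * min 1 ‖h‖ ^ n) := by gcongr; exact h₁ h
      _ = (2 * C₁) * min 1 ‖k‖ * min 1 ‖h‖ ^ n := by rw [min_eq_left h1]; ring
      _ ≤ _ := by gcongr; exact le_max_left _ _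
  · refine ((hκ.fwdDiff_iter h n).integral_norm_fwdDiff_le_norm_mul k).trans ?_
    rw [hκ.fderiv_fwdDiff_iter]
    calc _ ≤ ‖k‖ * (C₂ * min 1 ‖h‖ ^ n) := by gcongr; exact h₂ h
      _ = C₂ * min 1 ‖k‖ * min 1 ‖h‖ ^ n := by rw [min_eq_right h1]; ring
      _ ≤ _ := by gcongr; exact le_max_right _ _

end IsTestFun

/-- Converts integer orders of differences into fractional exponents `r ≤ n`; the case `n = 0`, `r =
0` is needed for plain `L¹` bounds. -/
lemma min_one_pow_le_rpow {x r : ℝ} {n : ℕ} (hx : 0 ≤ x) (hr : 0 ≤ r) (hn : r ≤ n) :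
    min 1 x ^ n ≤ x ^ r := by
  have h0 : 0 ≤ min 1 x := le_min zero_le_one hx
  calc min 1 x ^ n = min 1 x ^ (n : ℝ) := (Real.rpow_natCast _ _).symm
    _ ≤ min 1 x ^ r := by
      rcases h0.eq_or_lt with h | h
      · rw [← h]
        rcases hr.eq_or_lt with h' | h'
        · rw [← h', Real.rpow_zero]; exact Real.zero_rpow_le_one _
        · rw [Real.zero_rpow h'.ne', Real.zero_rpow (h'.trans_le hn).ne']
      · exact Real.rpow_le_rpow_of_exponent_ge h (min_le_left _ _) hn
    _ ≤ x ^ r := Real.rpow_le_rpow h0 (min_le_right _ _) hr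

/-! ### Dilations -/

/-- The kernel `ε^{-d} κ(· / ε)`. -/
def dilate (ε : ℝ) (κ : Euc d → ℝ) : Euc d → ℝ := fun x => (ε ^ d)⁻¹ * κ (ε⁻¹ • x)

lemma IsTestFun.dilate {κ : Euc d → ℝ} (hκ : IsTestFun κ) {ε : ℝ} (hε : 0 < ε) :
    IsTestFun (dilate ε κ) :=
  (hκ.comp_smul (inv_ne_zero hε.ne')).const_smul ((ε ^ d)⁻¹)

lemma integral_dilate_mul {ε : ℝ} (hε : 0 < ε) (κ φ : Euc d → ℝ) :
    ∫ x, dilate ε κ x * φ x = ∫ x, κ x * φ (ε • x) := by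
  have h := Measure.integral_comp_inv_smul_of_nonneg volume
    (fun x : Euc d => κ x * φ (ε • x)) hε.le
  simp only [smul_inv_smul₀ hε.ne', finrank_euclideanSpace, Fintype.card_fin, smul_eq_mul] at h
  simp only [dilate, mul_assoc]
  rw [integral_const_mul, h, inv_mul_cancel_left₀ (by positivity)]

lemma integral_norm_dilate {ε : ℝ} (hε : 0 < ε) (κ : Euc d → ℝ) :
    ∫ x, ‖dilate ε κ x‖ = ∫ x, ‖κ x‖ := by
  have h := integral_dilate_mul hε (fun x => ‖κ x‖) 1
  simp only [Pi.one_apply, mul_one] at h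
  rw [← h]
  refine integral_congr_ae (.of_forall fun x => ?_)
  simp [dilate, abs_of_pos hε]

lemma fwdDiff_dilate {ε : ℝ} (κ : Euc d → ℝ) (h : Euc d) :
    fwdDiff h (dilate ε κ) = dilate ε (fwdDiff (ε⁻¹ • h) κ) := by
  ext x
  simp only [fwdDiff, dilate, smul_add]
  ring

lemma fwdDiff_iter_dilate {ε : ℝ} (κ : Euc d → ℝ) (h : Euc d) (n : ℕ) :
    (fwdDiff h)^[n] (dilate ε κ) = dilate ε ((fwdDiff (ε⁻¹ • h))^[n] κ) := by
  induction n with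
  | zero => rfl
  | succ n ih => rw [iterate_succ_apply', iterate_succ_apply', ih, fwdDiff_dilate]

/-- The `L¹` norms of mixed differences of a dilated test function, with fractional exponents. -/
lemma IsTestFun.exists_integral_norm_fwdDiff_dilate_le {κ : Euc d → ℝ} (hκ : IsTestFun κ) {n : ℕ}
    {r α : ℝ} (hr : 0 ≤ r) (hrn : r ≤ n) (hα : 0 ≤ α) (hα1 : α ≤ 1) :
    ∃ C : ℝ, 0 ≤ C ∧ ∀ ε : ℝ, 0 < ε → ∀ h,
      ∫ x, ‖(_root_.fwdDiff h)^[n] (_root_.dilate ε κ) x‖ ≤ C * (‖h‖ / ε) ^ r ∧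
      ∀ k, ∫ x, ‖_root_.fwdDiff k ((_root_.fwdDiff h)^[n] (_root_.dilate ε κ)) x‖ ≤
        C * (‖k‖ / ε) ^ α * (‖h‖ / ε) ^ r := by
  obtain ⟨C₁, hC₁, h₁⟩ := exists_integral_norm_fwdDiff_iter_le n hκ
  obtain ⟨C₂, hC₂, h₂⟩ := hκ.exists_integral_norm_fwdDiff_fwdDiff_iter_le n
  have hn {ε : ℝ} (hε : 0 < ε) (h : Euc d) : ‖ε⁻¹ • h‖ = ‖h‖ / ε := by
    rw [norm_smul, norm_inv, Real.norm_of_nonneg hε.le, div_eq_inv_mul]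
  refine ⟨max C₁ C₂, le_max_of_le_left hC₁, fun ε hε h => ⟨?_, fun k => ?_⟩⟩
  · rw [fwdDiff_iter_dilate, integral_norm_dilate hε]
    refine (h₁ _).trans ?_
    rw [hn hε]
    gcongr
    · exact le_max_left _ _
    · exact min_one_pow_le_rpow (by positivity) hr hrn
  · rw [fwdDiff_iter_dilate, fwdDiff_dilate, integral_norm_dilate hε]
    refine (h₂ _ _).trans ?_
    rw [hn hε, hn hε]
    gcongr
    · exact le_max_right _ _
    · simpa using min_one_pow_le_rpow (n := 1) (x := ‖k‖ / ε) (by positivity) hα (by simpa using hα1)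
    · exact min_one_pow_le_rpow (by positivity) hr hrn

/-! ### Averaging operators, mollified measures and convolutions -/

/-- The averaging operator with kernel `κ`. -/
def kernelAvg (κ φ : Euc d → ℝ) (y : Euc d) : ℝ := ∫ u, κ u * φ (y + u)

/-- The density of the convolution of `κ(x) dx` with the measure `μ`. -/
def mollify (κ : Euc d → ℝ) (μ : Measure (Euc d)) (x : Euc d) : ℝ := ∫ y, κ (x - y) ∂μ

/-- The convolution of two kernels. -/
def conv (κ₁ κ₂ : Euc d → ℝ) : Euc d → ℝ :=
  convolution κ₁ κ₂ (ContinuousLinearMap.mul ℝ ℝ) volume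

lemma integrable_mul_translate {κ φ : Euc d → ℝ} {M : ℝ} (hκ : Integrable κ) (hφ : Measurable φ)
    (hM : ∀ x, |φ x| ≤ M) (y : Euc d) : Integrable fun u => κ u * φ (y + u) :=
  hκ.mul_bdd (hφ.comp (measurable_const_add y)).aestronglyMeasurable (.of_forall fun u => hM (y + u))

lemma abs_kernelAvg_le {κ φ : Euc d → ℝ} {M : ℝ} (hκ : Integrable κ) (hφ : Measurable φ)
    (hM : ∀ x, |φ x| ≤ M) (y : Euc d) : |kernelAvg κ φ y| ≤ M * ∫ x, ‖κ x‖ := by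
  rw [mul_comm, ← integral_mul_const]
  refine (norm_integral_le_integral_norm _).trans
    (integral_mono (integrable_mul_translate hκ hφ hM y).norm (hκ.norm.mul_const M) fun u => ?_)
  rw [norm_mul]
  exact mul_le_mul_of_nonneg_left (hM _) (norm_nonneg _)

lemma kernelAvg_eq_integral_sub (κ φ : Euc d → ℝ) (y : Euc d) :
    kernelAvg κ φ y = ∫ x, κ (x - y) * φ x := by
  rw [kernelAvg, ← integral_add_right_eq_self (fun x => κ (x - y) * φ x) y]
  simp [add_comm]

lemma kernelAvg_sub_left {κ κ' φ : Euc d → ℝ} {M : ℝ} (hκ : Integrable κ) (hκ' : Integrable κ')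
    (hφ : Measurable φ) (hM : ∀ x, |φ x| ≤ M) :
    kernelAvg (κ - κ') φ = kernelAvg κ φ - kernelAvg κ' φ := by
  ext y
  simp only [kernelAvg, Pi.sub_apply, sub_mul]
  exact integral_sub (integrable_mul_translate hκ hφ hM y) (integrable_mul_translate hκ' hφ hM y)

/-- Differences of an average fall on the kernel, so the Hölder norm of an average of a merely
bounded `φ` is controlled by `L¹` norms of differences of `κ`. -/
lemma fwdDiff_kernelAvg {κ φ : Euc d → ℝ} {M : ℝ} (hκ : Integrable κ) (hφ : Measurable φ)
    (hM : ∀ x, |φ x| ≤ M) (k : Euc d) :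
    fwdDiff k (kernelAvg κ φ) = kernelAvg (fwdDiff (-k) κ) φ := by
  have h1 : kernelAvg (fun u => κ (u + -k)) φ = fun y => kernelAvg κ φ (y + k) := by
    ext y
    rw [kernelAvg, kernelAvg, ← integral_sub_right_eq_self (fun u => κ u * φ (y + k + u)) k]
    simp [sub_eq_add_neg, add_assoc]
  change _ = kernelAvg ((fun u => κ (u + -k)) - κ) φ
  rw [kernelAvg_sub_left (hκ.comp_add_right _) hκ hφ hM, h1]
  rfl

lemma IsTestFun.conv {κ₁ κ₂ : Euc d → ℝ} (h₁ : IsTestFun κ₁) (h₂ : IsTestFun κ₂) :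
    IsTestFun (conv κ₁ κ₂) :=
  ⟨h₂.compact.contDiff_convolution_right (n := ⊤) _ h₁.continuous.locallyIntegrable h₂.smooth,
    h₁.compact.convolution _ h₂.compact⟩

lemma conv_comm (κ₁ κ₂ : Euc d → ℝ) : conv κ₁ κ₂ = conv κ₂ κ₁ := by
  rw [conv, ← convolution_flip]
  congr 1
  ext
  simp

lemma fwdDiff_conv {κ₁ κ₂ : Euc d → ℝ} (h₁ : IsTestFun κ₁) (h₂ : IsTestFun κ₂) (h : Euc d) :
    fwdDiff h (conv κ₁ κ₂) = conv κ₁ (fwdDiff h κ₂) := by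
  have hi {κ : Euc d → ℝ} (hκ : IsTestFun κ) (x : Euc d) :
      Integrable fun t => κ₁ t * κ (x - t) :=
    (h₁.continuous.mul (hκ.continuous.comp (by fun_prop))).integrable_of_hasCompactSupport
      h₁.compact.mul_right
  ext x
  simp only [fwdDiff, conv, convolution_def, ContinuousLinearMap.mul_apply', mul_sub]
  have h3 := hi (h₂.translate h) x
  rw [integral_sub h3 (hi h₂ x)]
  simp only [sub_add_eq_add_sub]

lemma fwdDiff_iter_conv {κ₁ κ₂ : Euc d → ℝ} (h₁ : IsTestFun κ₁) (h₂ : IsTestFun κ₂) (h : Euc d)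
    (n : ℕ) : (fwdDiff h)^[n] (conv κ₁ κ₂) = conv κ₁ ((fwdDiff h)^[n] κ₂) := by
  induction n with
  | zero => rfl
  | succ n ih =>
    rw [iterate_succ_apply', iterate_succ_apply', ih, fwdDiff_conv h₁ (h₂.fwdDiff_iter h n)]

/-- Fubini. Together with `conv_comm` this makes averaging operators commute. -/
lemma kernelAvg_conv {κ₁ κ₂ φ : Euc d → ℝ} {M : ℝ} (h₁ : Integrable κ₁) (h₂ : Integrable κ₂)
    (hφ : Measurable φ) (hM : ∀ x, |φ x| ≤ M) :
    kernelAvg (conv κ₁ κ₂) φ = kernelAvg κ₁ (kernelAvg κ₂ φ) := by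
  ext y
  have hint : Integrable (uncurry fun x t => κ₁ t * κ₂ (x - t) * φ (y + x))
      ((volume : Measure (Euc d)).prod volume) :=
    (h₁.convolution_integrand (ContinuousLinearMap.mul ℝ ℝ) h₂).mul_bdd
      (hφ.comp ((measurable_const_add y).comp measurable_fst)).aestronglyMeasurable
      (.of_forall fun p => hM (y + p.1))
  calc kernelAvg (conv κ₁ κ₂) φ y = ∫ x, ∫ t, κ₁ t * κ₂ (x - t) * φ (y + x) := by
        simp only [kernelAvg, integral_mul_const]
        rfl
    _ = ∫ t, ∫ x, κ₁ t * κ₂ (x - t) * φ (y + x) := integral_integral_swap hint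
    _ = ∫ t, κ₁ t * kernelAvg κ₂ φ (y + t) := by
        congr 1
        ext1 t
        simp only [mul_assoc, integral_const_mul]
        rw [kernelAvg, ← integral_sub_right_eq_self (fun u => κ₂ u * φ (y + t + u)) t]
        simp

lemma IsTestFun.kernelAvg {κ φ : Euc d → ℝ} {M : ℝ} (hκ : IsTestFun κ) (hφ : Measurable φ)
    (hM : ∀ x, |φ x| ≤ M) (hc : HasCompactSupport φ) : IsTestFun (kernelAvg κ φ) := by
  have h1 : _root_.kernelAvg κ φ =
      convolution φ (fun x => κ (-x)) (ContinuousLinearMap.mul ℝ ℝ) volume := by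
    ext y
    rw [kernelAvg_eq_integral_sub, convolution_def]
    simp [mul_comm]
  have h2 : LocallyIntegrable φ := by
    refine (locallyIntegrable_const M).mono hφ.aestronglyMeasurable (.of_forall fun x => ?_)
    exact (hM x).trans (le_abs_self M)
  rw [h1]
  exact ⟨hκ.comp_neg.compact.contDiff_convolution_right (n := ⊤) _ h2 hκ.comp_neg.smooth,
    hc.convolution _ hκ.comp_neg.compact⟩

section mollify

variable {κ : Euc d → ℝ} {μ : Measure (Euc d)} [IsFiniteMeasure μ]

lemma integrable_prod_sub (hκ : Integrable κ) :
    Integrable (uncurry fun x y => κ (x - y)) ((volume : Measure (Euc d)).prod μ) := by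
  -- The function is the convolution integrand of the constant `1`, integrable because `μ` is
  -- finite, with `κ`.
  have h := (integrable_const (1 : ℝ) (μ := μ)).convolution_integrand
    (ContinuousLinearMap.mul ℝ ℝ) hκ
  simpa [uncurry_def] using h

lemma integrable_mollify (hκ : Integrable κ) : Integrable (mollify κ μ) :=
  (integrable_prod_sub hκ).integral_prod_left

/-- By Fubini, mollification is dual to averaging; this transfers estimates on mollified measures to
integrals against `μ`. -/
lemma integral_mul_mollify (hκ : Integrable κ) {φ : Euc d → ℝ} {M : ℝ} (hφ : Measurable φ)
    (hM : ∀ x, |φ x| ≤ M) : ∫ x, φ x * mollify κ μ x = ∫ y, kernelAvg κ φ y ∂μ := by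
  have hint : Integrable (uncurry fun x y => κ (x - y) * φ x)
      ((volume : Measure (Euc d)).prod μ) :=
    (integrable_prod_sub hκ).mul_bdd (hφ.comp measurable_fst).aestronglyMeasurable
      (.of_forall fun p => hM p.1)
  calc ∫ x, φ x * mollify κ μ x = ∫ x, ∫ y, κ (x - y) * φ x ∂μ := by
        simp only [mollify, integral_mul_const, mul_comm (φ _)]
    _ = ∫ y, ∫ x, κ (x - y) * φ x ∂volume ∂μ := integral_integral_swap hint
    _ = _ := by simp only [kernelAvg_eq_integral_sub]

lemma integral_norm_mollify_le (hκ : Integrable κ) :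
    ∫ x, ‖mollify κ μ x‖ ≤ μ.real univ * ∫ x, ‖κ x‖ := by
  have hint := integrable_prod_sub (μ := μ) hκ.norm
  calc ∫ x, ‖mollify κ μ x‖ ≤ ∫ x, ∫ y, ‖κ (x - y)‖ ∂μ :=
        integral_mono (integrable_mollify hκ).norm hint.integral_prod_left
          fun x => norm_integral_le_integral_norm _
    _ = ∫ y, ∫ x, ‖κ (x - y)‖ ∂volume ∂μ := integral_integral_swap hint
    _ = _ := by
        simp only [integral_sub_right_eq_self (fun x => ‖κ x‖), integral_const, smul_eq_mul]

lemma IsTestFun.integrable_sub_left (hκ : IsTestFun κ) (x : Euc d) :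
    Integrable (fun y => κ (x - y)) μ := by
  obtain ⟨C, hC⟩ := hκ.continuous.bounded_above_of_compact_support hκ.compact
  exact Integrable.of_bound (hκ.continuous.comp (by fun_prop)).aestronglyMeasurable C
    (.of_forall fun y => hC _)

lemma mollify_sub_left {κ' : Euc d → ℝ} (hκ : IsTestFun κ) (hκ' : IsTestFun κ') :
    mollify (κ - κ') μ = mollify κ μ - mollify κ' μ := by
  ext x
  exact integral_sub (hκ.integrable_sub_left x) (hκ'.integrable_sub_left x)

lemma fwdDiff_mollify (hκ : IsTestFun κ) (h : Euc d) :
    fwdDiff h (mollify κ μ) = mollify (fwdDiff h κ) μ := by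
  ext x
  change _ = mollify ((fun y => κ (y + h)) - κ) μ x
  rw [mollify_sub_left (hκ.translate h) hκ]
  simp [fwdDiff, mollify, sub_add_eq_add_sub]

lemma fwdDiff_iter_mollify (hκ : IsTestFun κ) (h : Euc d) (n : ℕ) :
    (fwdDiff h)^[n] (mollify κ μ) = mollify ((fwdDiff h)^[n] κ) μ := by
  induction n with
  | zero => rfl
  | succ n ih =>
    rw [iterate_succ_apply', iterate_succ_apply', ih, fwdDiff_mollify (hκ.fwdDiff_iter h n)]

/-- Cutting `μ` off to a ball makes its mollification compactly supported, which provides the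
Schwartz approximants. -/
lemma IsTestFun.mollify_restrict (hκ : IsTestFun κ) (R : ℝ) :
    IsTestFun (mollify κ (μ.restrict (Metric.closedBall 0 R))) := by
  constructor
  · have h1 : mollify κ (μ.restrict (Metric.closedBall 0 R)) =
        convolution (fun _ => (1 : ℝ)) κ (ContinuousLinearMap.mul ℝ ℝ)
          (μ.restrict (Metric.closedBall 0 R)) := by
      ext x
      simp [mollify, convolution_def]
    rw [h1]
    exact hκ.compact.contDiff_convolution_right (n := ⊤) _ (locallyIntegrable_const _) hκ.smooth
  · obtain ⟨r, hr⟩ := hκ.compact.isCompact.isBounded.subset_closedBall 0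
    refine HasCompactSupport.intro (isCompact_closedBall (0 : Euc d) (r + R)) fun x hx => ?_
    rw [mollify, setIntegral_eq_zero_of_forall_eq_zero]
    intro y hy
    by_contra h0
    have h1 := hr (subset_tsupport _ (mem_support.2 h0))
    rw [mem_closedBall_zero_iff] at h1 hy hx
    apply hx
    calc ‖x‖ = ‖(x - y) + y‖ := by simp
      _ ≤ r + R := (norm_add_le _ _).trans (add_le_add h1 hy)

end mollify

/-! ### A reproducing kernel of higher order -/

lemma abs_fwdDiff_iter_le {g : Euc d → ℝ} {M : ℝ} (hM : ∀ y, |g y| ≤ M) (h : Euc d) (n : ℕ)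
    (y : Euc d) : |(fwdDiff h)^[n] g y| ≤ 2 ^ n * M := by
  induction n generalizing y with
  | zero => simpa using hM y
  | succ n ih =>
    rw [iterate_succ_apply', fwdDiff, pow_succ]
    refine (abs_sub _ _).trans ?_
    linarith [ih y, ih (y + h)]

/-- A smooth probability density supported in the unit ball. -/
def bumpKernel (d : ℕ) : Euc d → ℝ :=
  (⟨1 / 2, 1, by norm_num, by norm_num⟩ : ContDiffBump (0 : Euc d)).normed volume

lemma isTestFun_bumpKernel : IsTestFun (bumpKernel d) :=
  ⟨ContDiffBump.contDiff_normed (n := ⊤) _, ContDiffBump.hasCompactSupport_normed _⟩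

lemma bumpKernel_nonneg (x : Euc d) : 0 ≤ bumpKernel d x := ContDiffBump.nonneg_normed _ x

lemma integral_bumpKernel : ∫ x, bumpKernel d x = 1 := ContDiffBump.integral_normed _

lemma bumpKernel_eq_zero {x : Euc d} (hx : 1 < ‖x‖) : bumpKernel d x = 0 := by
  by_contra h
  have h1 : x ∈ support (bumpKernel d) := h
  rw [bumpKernel, ContDiffBump.support_normed_eq, mem_ball_zero_iff] at h1
  exact lt_asymm hx h1

/-- The combination of dilates of `bumpKernel` for which averaging minus the identity is an average
of differences of order `m`. -/
def reprKernel (d m : ℕ) : Euc d → ℝ :=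
  ∑ k ∈ Finset.range m, ((-1) ^ k * (m.choose (k + 1) : ℝ)) • dilate (k + 1) (bumpKernel d)

lemma isTestFun_reprKernel (m : ℕ) : IsTestFun (reprKernel d m) :=
  IsTestFun.sum _ fun k _ => (isTestFun_bumpKernel.dilate (by positivity)).const_smul _

/-- In the binomial expansion of `Δ_{εu}^m g(y)` the term of index 0 is `(-1)^m g(y)`. The term of
index `k + 1`, averaged over `u`, is an average of `g` with the bump dilated by `(k + 1) ε`. The
coefficients of `reprKernel` are the binomial ones after solving for `g(y)`. -/
lemma kernelAvg_reprKernel_sub {g : Euc d → ℝ} {M : ℝ} (hg : Continuous g) (hM : ∀ y, |g y| ≤ M)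
    (m : ℕ) {ε : ℝ} (hε : 0 < ε) (y : Euc d) :
    kernelAvg (dilate ε (reprKernel d m)) g y - g y =
      -(-1) ^ m * ∫ u, bumpKernel d u * (fwdDiff (ε • u))^[m] g y := by
  have hi (κ : Euc d → ℝ) (hκ : IsTestFun κ) (r : ℝ) : Integrable fun u => κ u * g (y + r • u) :=
    hκ.integrable.mul_bdd (hg.comp (by fun_prop)).aestronglyMeasurable (.of_forall fun u => hM _)
  have h1 : kernelAvg (dilate ε (reprKernel d m)) g y = ∑ k ∈ Finset.range m,
      ((-1) ^ k * (m.choose (k + 1) : ℝ)) *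
        ∫ u, bumpKernel d u * g (y + (((k + 1 : ℕ) : ℝ) * ε) • u) := by
    rw [kernelAvg, integral_dilate_mul hε _ fun u => g (y + u)]
    simp only [reprKernel, Finset.sum_apply, Finset.sum_mul, Pi.smul_apply, smul_eq_mul, mul_assoc]
    rw [integral_finsetSum]
    · refine Finset.sum_congr rfl fun k _ => ?_
      rw [integral_const_mul, integral_const_mul,
        integral_dilate_mul (by positivity) _ fun u => g (y + ε • u)]
      simp [smul_smul, mul_comm]
    · intro k _
      exact ((hi _ (isTestFun_bumpKernel.dilate (by positivity)) ε).const_mul _).const_mul _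
  have h2 : ∫ u, bumpKernel d u * (fwdDiff (ε • u))^[m] g y = ∑ k ∈ Finset.range (m + 1),
      ((-1) ^ (m - k) * (m.choose k : ℝ)) *
        ∫ u, bumpKernel d u * g (y + ((k : ℝ) * ε) • u) := by
    have h3 (u : Euc d) : bumpKernel d u * (fwdDiff (ε • u))^[m] g y =
        ∑ k ∈ Finset.range (m + 1), ((-1) ^ (m - k) * (m.choose k : ℝ)) *
          (bumpKernel d u * g (y + ((k : ℝ) * ε) • u)) := by
      rw [fwdDiff_iter_eq_sum_shift, Finset.mul_sum]
      refine Finset.sum_congr rfl fun k _ => ?_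
      rw [zsmul_eq_mul, ← Nat.cast_smul_eq_nsmul ℝ, smul_smul]
      push_cast
      ring
    simp only [h3]
    rw [integral_finsetSum _ fun k _ => (hi _ isTestFun_bumpKernel _).const_mul _]
    simp only [integral_const_mul]
  rw [h1, h2, Finset.sum_range_succ', mul_add, Finset.mul_sum]
  have h4 : ∫ u, bumpKernel d u * g (y + (((0 : ℕ) : ℝ) * ε) • u) = g y := by
    simp [integral_mul_const, integral_bumpKernel]
  rw [h4, sub_eq_add_neg]
  congr 1
  · refine Finset.sum_congr rfl fun k hk => ?_
    have hkm : k + 1 ≤ m := Finset.mem_range.1 hk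
    obtain ⟨l, rfl⟩ := Nat.exists_eq_add_of_le hkm
    have h5 : ((-1 : ℝ)) ^ l * (-1) ^ l = 1 := by rw [← mul_pow]; simp
    rw [Nat.add_sub_cancel_left, ← mul_assoc, ← mul_assoc]
    congr 2
    rw [pow_add, pow_succ]
    linear_combination (-(-1) ^ k) * h5
  · have h5 : ((-1 : ℝ)) ^ m * (-1) ^ m = 1 := by rw [← mul_pow]; simp
    simp only [Nat.sub_zero, Nat.choose_zero_right, Nat.cast_one]
    linear_combination g y * h5

lemma integral_reprKernel {m : ℕ} (hm : m ≠ 0) : ∫ u, reprKernel d m u = 1 := by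
  -- Apply the identity to the constant 1, all of whose differences of positive order vanish.
  have h := kernelAvg_reprKernel_sub (d := d) (g := fun _ => 1) (M := 1) continuous_const (by simp)
    m one_pos 0
  obtain ⟨k, rfl⟩ := Nat.exists_eq_succ_of_ne_zero hm
  have h0 (u : Euc d) : (fwdDiff ((1 : ℝ) • u))^[k + 1] (fun _ : Euc d => (1 : ℝ)) 0 = 0 := by
    rw [iterate_succ_apply, fwdDiff_const, fwdDiff_iter_zero_fun]
  simp only [Nat.succ_eq_add_one, h0, mul_zero, integral_zero] at h
  simp only [kernelAvg, dilate, one_pow, inv_one, one_mul, one_smul, mul_one] at h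
  exact sub_eq_zero.1 h

/-- The kernel of two successive averages with `reprKernel` at scale `ε`. -/
def doubleKernel (d m : ℕ) (ε : ℝ) : Euc d → ℝ :=
  conv (dilate ε (reprKernel d m)) (dilate ε (reprKernel d m))

lemma isTestFun_doubleKernel (m : ℕ) {ε : ℝ} (hε : 0 < ε) : IsTestFun (doubleKernel d m ε) :=
  ((isTestFun_reprKernel m).dilate hε).conv ((isTestFun_reprKernel m).dilate hε)

lemma kernelAvg_dilate {ε : ℝ} (hε : 0 < ε) (κ φ : Euc d → ℝ) (y : Euc d) :
    kernelAvg (dilate ε κ) φ y = ∫ u, κ u * φ (y + ε • u) :=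
  integral_dilate_mul hε _ fun u => φ (y + u)

section limit

variable {m : ℕ} {φ : Euc d → ℝ} {M : ℝ} {ε : ℕ → ℝ}

/-- The evaluation point moves with `j` because the outer average in `doubleKernel` evaluates the
inner one at `y + ε j • u`. -/
lemma tendsto_kernelAvg_reprKernel (hm : m ≠ 0) (hφ : Continuous φ) (hM : ∀ x, |φ x| ≤ M)
    (hε : ∀ j, 0 < ε j) (hε0 : Tendsto ε atTop (𝓝 0)) {z : ℕ → Euc d} {y : Euc d}
    (hz : Tendsto z atTop (𝓝 y)) :
    Tendsto (fun j => kernelAvg (dilate (ε j) (reprKernel d m)) φ (z j)) atTop (𝓝 (φ y)) := by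
  have hΨ := isTestFun_reprKernel (d := d) m
  have h1 : φ y = ∫ u, reprKernel d m u * φ y := by
    rw [integral_mul_const, integral_reprKernel hm, one_mul]
  simp only [kernelAvg_dilate (hε _)]
  rw [h1]
  refine tendsto_integral_of_dominated_convergence (fun u => ‖reprKernel d m u‖ * M) (fun j => ?_)
    (hΨ.integrable.norm.mul_const M) (fun j => .of_forall fun u => ?_) (.of_forall fun u => ?_)
  · exact (hΨ.continuous.mul (hφ.comp (by fun_prop))).aestronglyMeasurable
  · rw [norm_mul]
    exact mul_le_mul_of_nonneg_left (hM _) (norm_nonneg _)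
  · refine ((hφ.tendsto y).comp ?_).const_mul _
    simpa using hz.add (hε0.smul_const u)

lemma tendsto_kernelAvg_doubleKernel (hm : m ≠ 0) (hφ : Continuous φ) (hM : ∀ x, |φ x| ≤ M)
    (hε : ∀ j, 0 < ε j) (hε0 : Tendsto ε atTop (𝓝 0)) (y : Euc d) :
    Tendsto (fun j => kernelAvg (doubleKernel d m (ε j)) φ y) atTop (𝓝 (φ y)) := by
  have hΨ := isTestFun_reprKernel (d := d) m
  have hΨε (j : ℕ) := hΨ.dilate (hε j)
  have h1 : φ y = ∫ u, reprKernel d m u * φ y := by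
    rw [integral_mul_const, integral_reprKernel hm, one_mul]
  have h2 (j : ℕ) : kernelAvg (doubleKernel d m (ε j)) φ y = ∫ u, reprKernel d m u *
      kernelAvg (dilate (ε j) (reprKernel d m)) φ (y + ε j • u) := by
    rw [doubleKernel, kernelAvg_conv (hΨε j).integrable (hΨε j).integrable hφ.measurable hM,
      kernelAvg_dilate (hε j)]
  simp only [h2]
  rw [h1]
  have hcont (j : ℕ) : Continuous fun u =>
      kernelAvg (dilate (ε j) (reprKernel d m)) φ (y + ε j • u) := by
    simp only [kernelAvg_dilate (hε _)]
    refine continuous_of_dominated (bound := fun v => ‖reprKernel d m v‖ * M)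
      (fun u => (hΨ.continuous.mul (hφ.comp (by fun_prop))).aestronglyMeasurable)
      (fun u => .of_forall fun v => ?_) (hΨ.integrable.norm.mul_const M) (.of_forall fun v => ?_)
    · rw [norm_mul]
      exact mul_le_mul_of_nonneg_left (hM _) (norm_nonneg _)
    · exact continuous_const.mul (hφ.comp (by fun_prop))
  refine tendsto_integral_of_dominated_convergence
    (fun u => ‖reprKernel d m u‖ * (M * ∫ x, ‖reprKernel d m x‖)) (fun j => ?_)
    (hΨ.integrable.norm.mul_const _) (fun j => .of_forall fun u => ?_) (.of_forall fun u => ?_)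
  · exact (hΨ.continuous.mul (hcont j)).aestronglyMeasurable
  · rw [norm_mul, ← integral_norm_dilate (hε j)]
    exact mul_le_mul_of_nonneg_left (abs_kernelAvg_le (hΨε j).integrable hφ.measurable hM _)
      (norm_nonneg _)
  · refine (tendsto_kernelAvg_reprKernel hm hφ hM hε hε0 ?_).const_mul _
    simpa using tendsto_const_nhds.add (hε0.smul_const u)

lemma abs_kernelAvg_doubleKernel_le (hφ : Continuous φ) (hM : ∀ x, |φ x| ≤ M) {ε : ℝ}
    (hε : 0 < ε) (y : Euc d) :
    |kernelAvg (doubleKernel d m ε) φ y| ≤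
      M * (∫ x, ‖reprKernel d m x‖) * ∫ x, ‖reprKernel d m x‖ := by
  have hΨ := (isTestFun_reprKernel (d := d) m).dilate hε
  have hM0 : 0 ≤ M := (abs_nonneg _).trans (hM 0)
  have h1 := integral_norm_dilate hε (reprKernel d m)
  have h2 (z : Euc d) := abs_kernelAvg_le hΨ.integrable hφ.measurable hM z
  have h3 : Measurable (kernelAvg (dilate ε (reprKernel d m)) φ) := by
    have : StronglyMeasurable (uncurry fun y u : Euc d =>
        dilate ε (reprKernel d m) u * φ (y + u)) :=
      ((hΨ.continuous.comp continuous_snd).mul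
        (hφ.comp (continuous_fst.add continuous_snd))).stronglyMeasurable
    exact this.integral_prod_right.measurable
  rw [doubleKernel, kernelAvg_conv hΨ.integrable hΨ.integrable hφ.measurable hM]
  have h4 := abs_kernelAvg_le hΨ.integrable h3 h2 y
  rwa [h1] at h4

end limit

/-! ### Measures with a smoothing bound -/

/-- `|∫ Δ_h^m g dμ| ≤ K |h|^s ‖g‖_{C^α}` for all test functions `g`, where the Hölder norm enters
through an upper bound `M`. -/
def SmoothingBound (μ : Measure (Euc d)) (m : ℕ) (α s K : ℝ) : Prop :=
  ∀ g : Euc d → ℝ, IsTestFun g → ∀ M : ℝ, (∀ y, |g y| ≤ M) →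
    (∀ k y, |fwdDiff k g y| ≤ M * ‖k‖ ^ α) →
    ∀ h : Euc d, ‖h‖ ≤ 1 → |∫ y, (fwdDiff h)^[m] g y ∂μ| ≤ K * ‖h‖ ^ s * M

section SmoothingBound

variable {μ : Measure (Euc d)} [IsProbabilityMeasure μ] {m n : ℕ} {α s K r : ℝ}

/-- Fubini in `kernelAvg_reprKernel_sub` leaves a probability average over `u` of `∫ Δ_{εu}^m g dμ`.
Only `‖u‖ ≤ 1` contributes, so the steps are at most `ε ≤ 1` and the smoothing bound applies. -/
lemma SmoothingBound.abs_integral_kernelAvg_sub_le (H : SmoothingBound μ m α s K) (hs : 0 ≤ s)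
    (hK : 0 ≤ K) {g : Euc d → ℝ} (hg : IsTestFun g) {M : ℝ} (hM : ∀ y, |g y| ≤ M)
    (hMα : ∀ k y, |fwdDiff k g y| ≤ M * ‖k‖ ^ α) {ε : ℝ} (hε : 0 < ε) (hε1 : ε ≤ 1) :
    |∫ y, (kernelAvg (dilate ε (reprKernel d m)) g y - g y) ∂μ| ≤ K * ε ^ s * M := by
  have hM0 : 0 ≤ M := (abs_nonneg _).trans (hM 0)
  have hψ := isTestFun_bumpKernel (d := d)
  have hcont : Continuous fun p : Euc d × Euc d => (fwdDiff (ε • p.2))^[m] g p.1 := by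
    simp only [fwdDiff_iter_eq_sum_shift, zsmul_eq_mul]
    refine continuous_finsetSum _ fun k _ => continuous_const.mul ?_
    exact hg.continuous.comp (by fun_prop : Continuous fun p : Euc d × Euc d => p.1 + k • ε • p.2)
  have hint : Integrable (uncurry fun y u => bumpKernel d u * (fwdDiff (ε • u))^[m] g y)
      (μ.prod volume) :=
    (hψ.integrable.comp_snd μ).mul_bdd hcont.aestronglyMeasurable
      (.of_forall fun p => abs_fwdDiff_iter_le hM _ m _)
  have h1 : |∫ y, (kernelAvg (dilate ε (reprKernel d m)) g y - g y) ∂μ| =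
      |∫ u, bumpKernel d u * ∫ y, (fwdDiff (ε • u))^[m] g y ∂μ| := by
    simp only [kernelAvg_reprKernel_sub hg.continuous hM m hε, integral_const_mul, abs_mul, abs_neg,
      abs_pow, abs_one, one_pow, one_mul]
    rw [integral_integral_swap hint]
    simp only [integral_const_mul]
  have h2 : K * ε ^ s * M = ∫ u, bumpKernel d u * (K * ε ^ s * M) := by
    rw [integral_mul_const, integral_bumpKernel, one_mul]
  rw [h1, h2, ← Real.norm_eq_abs]
  refine norm_integral_le_of_norm_le (hψ.integrable.mul_const _) (.of_forall fun u => ?_)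
  rw [norm_mul, Real.norm_of_nonneg (bumpKernel_nonneg u)]
  rcases le_or_gt ‖u‖ 1 with hu | hu
  · refine mul_le_mul_of_nonneg_left ?_ (bumpKernel_nonneg u)
    have h3 : ‖ε • u‖ ≤ ε := by
      rw [norm_smul, Real.norm_of_nonneg hε.le]
      exact mul_le_of_le_one_right hε.le hu
    refine (H g hg M hM hMα _ (h3.trans hε1)).trans ?_
    gcongr
  · simp [bumpKernel_eq_zero hu]

lemma measurable_mollify {κ : Euc d → ℝ} (hκ : Continuous κ) : Measurable (mollify κ μ) := by
  have : StronglyMeasurable (uncurry fun x y : Euc d => κ (x - y)) :=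
    (hκ.comp continuous_sub).stronglyMeasurable
  exact this.integral_prod_right.measurable

/-- The `L¹` norm is computed by testing against bounded functions with compact support. -/
lemma integral_norm_le_of_forall_integral_mul_le {F : Euc d → ℝ} (hF : Measurable F)
    (hFi : Integrable F) {B : ℝ}
    (hB : ∀ φ : Euc d → ℝ, Measurable φ → (∀ x, |φ x| ≤ 1) → HasCompactSupport φ →
      ∫ x, φ x * F x ≤ B) : ∫ x, ‖F x‖ ≤ B := by
  refine le_of_tendsto' ((aecover_closedBall (x := (0 : Euc d))
    tendsto_natCast_atTop_atTop).integral_tendsto_of_countably_generated hFi.norm) fun R => ?_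
  have hsign : Measurable fun x => (SignType.sign (F x) : ℝ) := by
    have : (fun x => (SignType.sign (F x) : ℝ)) =
        fun x => if 0 < F x then 1 else if F x < 0 then -1 else 0 := by
      ext x
      rcases lt_trichotomy (F x) 0 with h | h | h
      · simp [h, not_lt.2 h.le]
      · simp [h]
      · simp [h]
    rw [this]
    exact Measurable.ite (measurableSet_lt measurable_const hF) measurable_const
      (Measurable.ite (measurableSet_lt hF measurable_const) measurable_const measurable_const)
  -- The sign of `F` is optimal but not compactly supported, hence the truncation to balls. Compact
  -- support of `φ` is what later makes its averages test functions.
  have h := hB ((Metric.closedBall 0 R).indicator fun x => (SignType.sign (F x) : ℝ))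
    (hsign.indicator Metric.isClosed_closedBall.measurableSet) (fun x => ?_)
    (HasCompactSupport.intro (isCompact_closedBall (0 : Euc d) R) fun x hx =>
      indicator_of_notMem hx _)
  · refine le_trans (le_of_eq ?_) h
    rw [← integral_indicator Metric.isClosed_closedBall.measurableSet]
    congr 1
    ext x
    by_cases hx : x ∈ Metric.closedBall (0 : Euc d) R
    · simp only [indicator_of_mem hx, Real.norm_eq_abs]
      exact (sign_mul_self (F x)).symm
    · simp [indicator_of_notMem hx]
  · by_cases hx : x ∈ Metric.closedBall (0 : Euc d) R
    · rw [indicator_of_mem hx]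
      rcases lt_trichotomy (F x) 0 with h | h | h <;> simp [h]
    · simp [indicator_of_notMem hx]

/-- All differences go to the inner factor; the outer one remains a plain average, which the
smoothing bound can remove. -/
lemma kernelAvg_fwdDiff_iter_doubleKernel (m n : ℕ) {ε : ℝ} (hε : 0 < ε) (h : Euc d)
    {φ : Euc d → ℝ} (hφ : Measurable φ) (hM : ∀ x, |φ x| ≤ 1) :
    kernelAvg ((fwdDiff h)^[n] (doubleKernel d m ε)) φ =
      kernelAvg (dilate ε (reprKernel d m))
        (kernelAvg ((fwdDiff h)^[n] (dilate ε (reprKernel d m))) φ) := by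
  have hΨ := (isTestFun_reprKernel (d := d) m).dilate hε
  rw [doubleKernel, fwdDiff_iter_conv hΨ hΨ,
    kernelAvg_conv hΨ.integrable (hΨ.fwdDiff_iter h n).integrable hφ hM]

/-- The increments of the mollifications of a measure with a smoothing bound. -/
lemma exists_integral_norm_fwdDiff_mollify_le (d m n : ℕ) {α r s : ℝ} (hr : 0 ≤ r) (hrn : r ≤ n)
    (hα : 0 ≤ α) (hα1 : α ≤ 1) (hs : 0 ≤ s) :
    ∃ C : ℝ, 0 ≤ C ∧ ∀ (μ : Measure (Euc d)) [IsProbabilityMeasure μ] (K : ℝ), 0 ≤ K →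
      SmoothingBound μ m α s K → ∀ ε : ℝ, 0 < ε → ε ≤ 1 → ∀ h : Euc d,
      ∫ x, ‖(fwdDiff h)^[n]
        (mollify (doubleKernel d m (ε / 2)) μ - mollify (doubleKernel d m ε) μ) x‖ ≤
        C * K * ε ^ (s - α - r) * ‖h‖ ^ r := by
  have hΨ := isTestFun_reprKernel (d := d) m
  obtain ⟨C, hC, hCε⟩ := hΨ.exists_integral_norm_fwdDiff_dilate_le hr hrn hα hα1
  refine ⟨4 * (C * 2 ^ α * 2 ^ r), by positivity, fun μ _ K hK H ε hε hε1 h => ?_⟩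
  have hε2 : 0 < ε / 2 := by positivity
  -- A common bound for the sup and Hölder norms of `G η` below, for both `η = ε` and `η = ε / 2`.
  set M : ℝ := C * (2 / ε) ^ α * (2 * ‖h‖ / ε) ^ r with hMdef
  have hΨε {η : ℝ} (hη : 0 < η) := hΨ.dilate hη
  have h₁ := isTestFun_doubleKernel (d := d) m hε2
  have h₂ := isTestFun_doubleKernel (d := d) m hε
  rw [fwdDiff_iter_sub, fwdDiff_iter_mollify h₁, fwdDiff_iter_mollify h₂,
    ← mollify_sub_left (h₁.fwdDiff_iter h n) (h₂.fwdDiff_iter h n)]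
  have ht := (h₁.fwdDiff_iter h n).sub (h₂.fwdDiff_iter h n)
  refine integral_norm_le_of_forall_integral_mul_le (measurable_mollify ht.continuous)
    (integrable_mollify ht.integrable) fun φ hφ hφ1 hφc => ?_
  rw [integral_mul_mollify ht.integrable hφ hφ1, kernelAvg_sub_left
    (h₁.fwdDiff_iter h n).integrable (h₂.fwdDiff_iter h n).integrable hφ hφ1,
    kernelAvg_fwdDiff_iter_doubleKernel m n hε2 h hφ hφ1, kernelAvg_fwdDiff_iter_doubleKernel m n hε h hφ hφ1]
  set A : ℝ → (Euc d → ℝ) → Euc d → ℝ := fun η => kernelAvg (dilate η (reprKernel d m)) with hA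
  set G : ℝ → Euc d → ℝ := fun η =>
    kernelAvg ((fwdDiff h)^[n] (dilate η (reprKernel d m))) φ with hG
  have hGtest {η : ℝ} (hη : 0 < η) : IsTestFun (G η) :=
    ((hΨε hη).fwdDiff_iter h n).kernelAvg hφ hφ1 hφc
  have hbound {η : ℝ} (hη : 0 < η) (hη2 : ε / 2 ≤ η) :
      (∀ y, |G η y| ≤ M) ∧ ∀ k y, |fwdDiff k (G η) y| ≤ M * ‖k‖ ^ α := by
    have hti := ((hΨε hη).fwdDiff_iter h n).integrable
    have hr' : (‖h‖ / η) ^ r ≤ (2 * ‖h‖ / ε) ^ r := by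
      refine Real.rpow_le_rpow (by positivity) ?_ hr
      rw [div_le_div_iff₀ hη hε]
      nlinarith [norm_nonneg h]
    have hinv : 1 / η ≤ 2 / ε := by
      rw [div_le_div_iff₀ hη hε]; linarith
    constructor
    · intro y
      refine (abs_kernelAvg_le hti hφ hφ1 y).trans ?_
      rw [one_mul]
      refine (hCε η hη h).1.trans ?_
      have h1 : 1 ≤ (2 / ε) ^ α :=
        Real.one_le_rpow (by rw [le_div_iff₀ hε]; linarith) hα
      calc C * (‖h‖ / η) ^ r ≤ C * 1 * (2 * ‖h‖ / ε) ^ r := by rw [mul_one]; gcongr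
        _ ≤ M := by rw [hMdef]; gcongr
    · intro k y
      rw [hG, fwdDiff_kernelAvg hti hφ hφ1]
      refine (abs_kernelAvg_le (((hΨε hη).fwdDiff_iter h n).fwdDiff (-k)).integrable
        hφ hφ1 y).trans ?_
      rw [one_mul]
      refine ((hCε η hη h).2 (-k)).trans ?_
      rw [norm_neg]
      calc C * (‖k‖ / η) ^ α * (‖h‖ / η) ^ r
          ≤ C * ((2 / ε) * ‖k‖) ^ α * (2 * ‖h‖ / ε) ^ r := by
            gcongr
            calc ‖k‖ / η = 1 / η * ‖k‖ := by ring
              _ ≤ _ := by gcongr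
        _ = M * ‖k‖ ^ α := by
            rw [hMdef, Real.mul_rpow (by positivity) (norm_nonneg _)]; ring
  have hM0 : 0 ≤ M := by positivity
  -- Inserting or removing one average, at either scale, costs at most `K ε^s M`.
  have herr {η ζ : ℝ} (hη : 0 < η) (hη2 : ε / 2 ≤ η) (hζ : 0 < ζ) (hζε : ζ ≤ ε) :
      |∫ y, A ζ (G η) y ∂μ - ∫ y, G η y ∂μ| ≤ K * ε ^ s * M := by
    obtain ⟨hb1, hb2⟩ := hbound hη hη2
    have hGi : Integrable (G η) μ :=
      Integrable.of_bound (hGtest hη).continuous.aestronglyMeasurable M (.of_forall hb1)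
    have hAi : Integrable (A ζ (G η)) μ := by
      have hAt : IsTestFun (A ζ (G η)) :=
        (hΨε hζ).kernelAvg (hGtest hη).continuous.measurable hb1 (hGtest hη).compact
      exact Integrable.of_bound hAt.continuous.aestronglyMeasurable _
        (.of_forall (abs_kernelAvg_le (hΨε hζ).integrable
          (hGtest hη).continuous.measurable hb1))
    rw [← integral_sub hAi hGi]
    refine (H.abs_integral_kernelAvg_sub_le hs hK (hGtest hη) hb1 hb2 hζ
      (hζε.trans hε1)).trans ?_
    gcongr
  -- This mixed term links the two scales. The chain `A (ε/2) (G (ε/2))`, `G (ε/2)`, `A ε (G (ε/2))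
  -- = A (ε/2) (G ε)`, `G ε`, `A ε (G ε)` has four steps, each an error of the type `herr`; hence
  -- the factor 4.
  have hcomm : A (ε / 2) (G ε) = A ε (G (ε / 2)) := by
    simp only [hA, hG]
    rw [← kernelAvg_conv (hΨε hε2).integrable ((hΨε hε).fwdDiff_iter h n).integrable hφ hφ1,
      ← kernelAvg_conv (hΨε hε).integrable ((hΨε hε2).fwdDiff_iter h n).integrable hφ hφ1,
      ← fwdDiff_iter_conv (hΨε hε2) (hΨε hε), ← fwdDiff_iter_conv (hΨε hε) (hΨε hε2), conv_comm]
  have hint {η : ℝ} (hη : 0 < η) (hη2 : ε / 2 ≤ η) : Integrable (A η (G η)) μ := by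
    have hAt : IsTestFun (A η (G η)) :=
      (hΨε hη).kernelAvg (hGtest hη).continuous.measurable (hbound hη hη2).1 (hGtest hη).compact
    exact Integrable.of_bound hAt.continuous.aestronglyMeasurable _
      (.of_forall (abs_kernelAvg_le (hΨε hη).integrable
        (hGtest hη).continuous.measurable (hbound hη hη2).1))
  change ∫ y, (A (ε / 2) (G (ε / 2)) y - A ε (G ε) y) ∂μ ≤ _
  rw [integral_sub (hint hε2 le_rfl) (hint hε (by linarith))]
  have e1 := herr hε2 le_rfl hε2 (by linarith)
  have e2 := herr hε2 le_rfl hε le_rfl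
  have e3 := herr hε (by linarith) hε2 (by linarith)
  have e4 := herr hε (by linarith) hε le_rfl
  rw [hcomm] at e3
  rw [abs_le] at e1 e2 e3 e4
  have hfin : 4 * (K * ε ^ s * M) =
      4 * (C * 2 ^ α * 2 ^ r) * K * ε ^ (s - α - r) * ‖h‖ ^ r := by
    rw [hMdef, Real.div_rpow (by norm_num) hε.le, Real.div_rpow (by positivity) hε.le,
      Real.mul_rpow (by norm_num) (norm_nonneg _), Real.rpow_sub hε, Real.rpow_sub hε]
    field_simp
  rw [← hfin]
  linarith [e1.1, e1.2, e2.1, e2.2, e3.1, e3.2, e4.1, e4.2]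

end SmoothingBound

/-! ### Besov norms -/

lemma MeasureTheory.AEStronglyMeasurable.fwdDiff_iter {f : Euc d → ℝ}
    (hf : AEStronglyMeasurable f) (h : Euc d) (n : ℕ) :
    AEStronglyMeasurable ((fwdDiff h)^[n] f) := by
  induction n with
  | zero => exact hf
  | succ n ih =>
    rw [iterate_succ_apply']
    exact (ih.comp_measurePreserving (measurePreserving_add_right volume h)).sub ih

lemma MeasureTheory.Integrable.fwdDiff_iter {f : Euc d → ℝ} (hf : Integrable f) (h : Euc d)
    (n : ℕ) : Integrable ((fwdDiff h)^[n] f) := by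
  induction n with
  | zero => exact hf
  | succ n ih =>
    rw [iterate_succ_apply']
    exact (ih.comp_add_right h).sub ih

lemma integral_norm_fwdDiff_iter_le {f : Euc d → ℝ} (hf : Integrable f) (h : Euc d) (n : ℕ) :
    ∫ x, ‖(fwdDiff h)^[n] f x‖ ≤ 2 ^ n * ∫ x, ‖f x‖ := by
  induction n with
  | zero => simp
  | succ n ih =>
    rw [iterate_succ_apply', pow_succ]
    linarith [integral_norm_fwdDiff_le_two_mul (hf.fwdDiff_iter h n) h]

lemma fwdDiff_iter_congr_ae {f g : Euc d → ℝ} (hfg : f =ᵐ[volume] g) (h : Euc d) (n : ℕ) :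
    (fwdDiff h)^[n] f =ᵐ[volume] (fwdDiff h)^[n] g := by
  induction n with
  | zero => exact hfg
  | succ n ih =>
    rw [iterate_succ_apply', iterate_succ_apply']
    have h1 := (measurePreserving_add_right (volume : Measure (Euc d)) h).quasiMeasurePreserving
      |>.ae_eq_comp ih
    exact h1.sub ih

lemma besovNorm_congr_ae {f g : Euc d → ℝ} (hfg : f =ᵐ[volume] g) (s : ℝ) (p : ℝ≥0∞) :
    besovNorm s p f = besovNorm s p g := by
  simp only [besovNorm, besovSeminorm, eLpNorm_congr_ae hfg,
    eLpNorm_congr_ae (fwdDiff_iter_congr_ae hfg _ _)]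

lemma besovNorm_add_le {f g : Euc d → ℝ} (hf : AEStronglyMeasurable f)
    (hg : AEStronglyMeasurable g) (s : ℝ) {p : ℝ≥0∞} (hp : 1 ≤ p) :
    besovNorm s p (f + g) ≤ besovNorm s p f + besovNorm s p g := by
  have h1 : besovSeminorm s p (f + g) ≤ besovSeminorm s p f + besovSeminorm s p g := by
    refine iSup₂_le fun h hh => ?_
    rw [fwdDiff_iter_add]
    refine (ENNReal.div_le_div_right
      (eLpNorm_add_le (hf.fwdDiff_iter h _) (hg.fwdDiff_iter h _) hp) _).trans ?_
    rw [ENNReal.add_div]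
    exact add_le_add (le_iSup₂_of_le h hh le_rfl) (le_iSup₂_of_le h hh le_rfl)
  calc besovNorm s p (f + g)
      ≤ (eLpNorm f p volume + eLpNorm g p volume) +
        (besovSeminorm s p f + besovSeminorm s p g) := add_le_add (eLpNorm_add_le hf hg hp) h1
    _ = _ := by simp only [besovNorm]; abel

lemma eLpNorm_one_eq_ofReal {f : Euc d → ℝ} (hf : Integrable f) :
    eLpNorm f 1 volume = ENNReal.ofReal (∫ x, ‖f x‖) := by
  rw [eLpNorm_one_eq_lintegral_enorm, ofReal_integral_norm_eq_lintegral_enorm hf]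

lemma besovNorm_one_le {f : Euc d → ℝ} (hf : Integrable f) {s A B : ℝ} (hA : ∫ x, ‖f x‖ ≤ A)
    (hB0 : 0 ≤ B) (hB : ∀ h, ∫ x, ‖(fwdDiff h)^[⌊s⌋₊ + 1] f x‖ ≤ B * ‖h‖ ^ s) :
    besovNorm s 1 f ≤ ENNReal.ofReal (A + B) := by
  have hA0 : 0 ≤ A := (integral_nonneg fun _ => norm_nonneg _).trans hA
  rw [ENNReal.ofReal_add hA0 hB0, besovNorm]
  refine add_le_add ?_ (iSup₂_le fun h hh => ?_)
  · rw [eLpNorm_one_eq_ofReal hf]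
    exact ENNReal.ofReal_le_ofReal hA
  · rw [eLpNorm_one_eq_ofReal (hf.fwdDiff_iter h _)]
    refine ENNReal.div_le_of_le_mul ?_
    rw [← ENNReal.ofReal_mul hB0]
    exact ENNReal.ofReal_le_ofReal (hB h)

/-! ### Approximation of mollified measures by Schwartz functions -/

/-- The bound is linear in the mass of `μ`, with a constant depending on `κ` and `a` only, so a tail
of small mass has small Besov norm. -/
lemma IsTestFun.exists_besovNorm_mollify_le {κ : Euc d → ℝ} (hκ : IsTestFun κ) {a : ℝ}
    (ha : 0 ≤ a) : ∃ C : ℝ, 0 ≤ C ∧ ∀ (μ : Measure (Euc d)) [IsFiniteMeasure μ],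
      besovNorm a 1 (mollify κ μ) ≤ ENNReal.ofReal (C * μ.real univ) := by
  obtain ⟨C, hC, hCh⟩ := exists_integral_norm_fwdDiff_iter_le (⌊a⌋₊ + 1) hκ
  refine ⟨(∫ x, ‖κ x‖) + C, by positivity, fun μ _ => ?_⟩
  rw [add_mul]
  refine besovNorm_one_le (integrable_mollify hκ.integrable) ?_ (by positivity) fun h => ?_
  · rw [mul_comm]
    exact integral_norm_mollify_le hκ.integrable
  · rw [fwdDiff_iter_mollify hκ]
    refine (integral_norm_mollify_le (hκ.fwdDiff_iter h _).integrable).trans ?_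
    rw [mul_comm C, mul_assoc]
    refine mul_le_mul_of_nonneg_left ((hCh h).trans ?_) measureReal_nonneg
    refine mul_le_mul_of_nonneg_left (min_one_pow_le_rpow (norm_nonneg _) ha ?_) hC
    exact_mod_cast (Nat.lt_floor_add_one a).le

lemma IsTestFun.memBesov_mollify {κ : Euc d → ℝ} (hκ : IsTestFun κ) {a : ℝ} (ha : 0 ≤ a)
    (μ : Measure (Euc d)) [IsFiniteMeasure μ] : MemBesov a 1 (mollify κ μ) := by
  intro η hη
  obtain ⟨C, hC, hCμ⟩ := hκ.exists_besovNorm_mollify_le ha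
  have hη' : ∃ η' : ℝ, 0 < η' ∧ ENNReal.ofReal η' ≤ η := by
    rcases eq_or_ne η ⊤ with rfl | h
    · exact ⟨1, one_pos, le_top⟩
    · exact ⟨η.toReal, ENNReal.toReal_pos hη.ne' h, ENNReal.ofReal_toReal_le⟩
  obtain ⟨η', hη'0, hη'⟩ := hη'
  have hpos : 0 < η' / (C + 1) := by positivity
  obtain ⟨K, -, hK, hKμ⟩ := MeasurableSet.univ.exists_isCompact_sdiff_lt (measure_ne_top μ univ)
    (ENNReal.ofReal_pos.2 hpos).ne'
  obtain ⟨R, hR⟩ := hK.isBounded.subset_closedBall 0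
  have hball : MeasurableSet (Metric.closedBall (0 : Euc d) R) :=
    Metric.isClosed_closedBall.measurableSet
  have ht := hκ.mollify_restrict (μ := μ) R
  refine ⟨ht.compact.toSchwartzMap ht.smooth, ?_⟩
  have heq : (fun y => mollify κ μ y - ht.compact.toSchwartzMap ht.smooth y) =
      mollify κ (μ.restrict (Metric.closedBall 0 R)ᶜ) := by
    ext x
    have h1 := integral_add_compl hball (hκ.integrable_sub_left (μ := μ) x)
    simp only [HasCompactSupport.toSchwartzMap_toFun, mollify]
    linarith
  rw [heq]
  refine (hCμ _).trans_lt (lt_of_lt_of_le ?_ hη')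
  have hlt : (μ.restrict (Metric.closedBall 0 R)ᶜ).real univ < η' / (C + 1) := by
    rw [measureReal_restrict_apply_univ]
    refine (ENNReal.toReal_lt_of_lt_ofReal (lt_of_le_of_lt (measure_mono ?_) hKμ))
    intro x hx
    exact ⟨mem_univ x, fun hxK => hx (hR hxK)⟩
  refine (ENNReal.ofReal_lt_ofReal_iff hη'0).2 ?_
  calc C * (μ.restrict (Metric.closedBall 0 R)ᶜ).real univ
      ≤ (C + 1) * (μ.restrict (Metric.closedBall 0 R)ᶜ).real univ := by gcongr; linarith
    _ < (C + 1) * (η' / (C + 1)) := by gcongr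
    _ = η' := by field_simp

/-! ### Limits of mollifications -/

lemma dist_toL1_eq_integral_norm {f g : Euc d → ℝ} (hf : Integrable f) (hg : Integrable g) :
    dist (hf.toL1 f) (hg.toL1 g) = ∫ x, ‖(f - g) x‖ := by
  rw [dist_eq_norm, ← Integrable.toL1_sub, L1.norm_of_fun_eq_integral_norm]

lemma exists_tendsto_integral_norm_sub {f : ℕ → Euc d → ℝ} (hf : ∀ j, Integrable (f j))
    {A q : ℝ} (hq1 : q < 1) (h : ∀ j, ∫ x, ‖(f (j + 1) - f j) x‖ ≤ A * q ^ j) :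
    ∃ g : Euc d → ℝ, Integrable g ∧ Tendsto (fun j => ∫ x, ‖(f j - g) x‖) atTop (𝓝 0) := by
  have hcau : CauchySeq fun j => (hf j).toL1 (f j) := by
    refine cauchySeq_of_le_geometric q A hq1 fun j => ?_
    rw [dist_comm, dist_toL1_eq_integral_norm]
    exact h j
  obtain ⟨G, hG⟩ := cauchySeq_tendsto_of_complete hcau
  refine ⟨G, L1.integrable_coeFn G, ?_⟩
  have h1 := tendsto_iff_dist_tendsto_zero.1 hG
  refine h1.congr fun j => ?_
  rw [← dist_toL1_eq_integral_norm (hf j) (L1.integrable_coeFn G), Integrable.toL1_coeFn]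

lemma integral_norm_sub_le_geometric {f : ℕ → Euc d → ℝ} (hf : ∀ j, Integrable (f j))
    {A q : ℝ} (hq1 : q < 1) (h : ∀ j, ∫ x, ‖(f (j + 1) - f j) x‖ ≤ A * q ^ j)
    {g : Euc d → ℝ} (hg : Integrable g)
    (hlim : Tendsto (fun j => ∫ x, ‖(f j - g) x‖) atTop (𝓝 0)) (j : ℕ) :
    ∫ x, ‖(g - f j) x‖ ≤ A * q ^ j / (1 - q) := by
  have h1 : Tendsto (fun j => (hf j).toL1 (f j)) atTop (𝓝 (hg.toL1 g)) := by
    rw [tendsto_iff_dist_tendsto_zero]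
    exact hlim.congr fun j => (dist_toL1_eq_integral_norm _ _).symm
  rw [← dist_toL1_eq_integral_norm hg (hf j), dist_comm]
  refine dist_le_of_le_geometric_of_tendsto q A hq1 (fun j => ?_) h1 j
  rw [dist_comm, dist_toL1_eq_integral_norm]
  exact h j

/-- A measure with a smoothing bound has a (weak) density with the expected Besov regularity. -/
theorem exists_density_of_smoothingBound (d : ℕ) {m : ℕ} {α s a : ℝ} (hm : m ≠ 0) (hα : 0 ≤ α)
    (hα1 : α ≤ 1) (ha : 0 ≤ a) (has : α + a < s) :
    ∃ C : ℝ, 0 < C ∧ ∀ (μ : Measure (Euc d)) [IsProbabilityMeasure μ] (K : ℝ), 1 ≤ K →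
      SmoothingBound μ m α s K → ∃ f : Euc d → ℝ, Integrable f ∧
        (∀ φ : BoundedContinuousFunction (Euc d) ℝ, ∫ x, φ x * f x = ∫ x, φ x ∂μ) ∧
        MemBesov a 1 f ∧ besovNorm a 1 f ≤ ENNReal.ofReal (C * K) := by
  have hs : 0 ≤ s := by linarith
  have han : a ≤ (⌊a⌋₊ + 1 : ℕ) := by exact_mod_cast (Nat.lt_floor_add_one a).le
  obtain ⟨C₀, hC₀, h₀⟩ := (isTestFun_doubleKernel (d := d) m one_pos).exists_besovNorm_mollify_le ha
  obtain ⟨C₁, hC₁, h₁⟩ :=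
    exists_integral_norm_fwdDiff_mollify_le d m 0 le_rfl (by simp) hα hα1 hs
  obtain ⟨C₂, hC₂, h₂⟩ :=
    exists_integral_norm_fwdDiff_mollify_le d m (⌊a⌋₊ + 1) ha han hα hα1 hs
  -- The ratio of the geometric series at the scales `2^(-j)`; it is below 1 because `s - α > a`.
  set q : ℝ := (1 / 2) ^ (s - α - a) with hq
  have hq0 : 0 < q := by positivity
  have hq1 : q < 1 := Real.rpow_lt_one (by norm_num) (by norm_num) (by linarith)
  have hq1' : 0 < 1 - q := sub_pos.2 hq1
  -- `C₀` bounds the mollification at scale 1 and the quotient sums the increments; the final 1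
  -- ensures positivity.
  refine ⟨C₀ + (C₁ + C₂) / (1 - q) + 1, by positivity, fun μ _ K hK H => ?_⟩
  have hK0 : 0 ≤ K := zero_le_one.trans hK
  set ε : ℕ → ℝ := fun j => (1 / 2) ^ j with hε
  have hε0 (j : ℕ) : 0 < ε j := by positivity
  have hε1 (j : ℕ) : ε j ≤ 1 := pow_le_one₀ (by norm_num) (by norm_num)
  have hεs (j : ℕ) : ε (j + 1) = ε j / 2 := by simp only [hε, pow_succ]; ring
  have hεq (j : ℕ) : ε j ^ (s - α - a) = q ^ j := by
    change ((1 / 2 : ℝ) ^ j) ^ (s - α - a) = q ^ j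
    rw [hq, ← Real.rpow_natCast, ← Real.rpow_natCast, ← Real.rpow_mul (by norm_num),
      ← Real.rpow_mul (by norm_num), mul_comm]
  set f : ℕ → Euc d → ℝ := fun j => mollify (doubleKernel d m (ε j)) μ with hf
  have htest (j : ℕ) := isTestFun_doubleKernel (d := d) m (hε0 j)
  have hfi (j : ℕ) : Integrable (f j) := integrable_mollify (htest j).integrable
  have hinc₁ (j : ℕ) : ∫ x, ‖(f (j + 1) - f j) x‖ ≤ C₁ * K * q ^ j := by
    have h := h₁ μ K hK0 H (ε j) (hε0 j) (hε1 j) 0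
    simp only [iterate_zero, id, sub_zero, Real.rpow_zero, mul_one] at h
    rw [← hεs j] at h
    refine h.trans (mul_le_mul_of_nonneg_left ?_ (by positivity))
    rw [← hεq j]
    exact Real.rpow_le_rpow_of_exponent_ge (hε0 j) (hε1 j) (by linarith)
  have hinc₂ (h : Euc d) (j : ℕ) : ∫ x, ‖((fwdDiff h)^[⌊a⌋₊ + 1] (f (j + 1)) -
      (fwdDiff h)^[⌊a⌋₊ + 1] (f j)) x‖ ≤ C₂ * K * ‖h‖ ^ a * q ^ j := by
    have h := h₂ μ K hK0 H (ε j) (hε0 j) (hε1 j) h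
    rw [← hεs j, hεq j, fwdDiff_iter_sub] at h
    refine h.trans (le_of_eq ?_)
    ring
  obtain ⟨g, hg, hlim⟩ := exists_tendsto_integral_norm_sub hfi hq1 hinc₁
  have hdist₁ (j : ℕ) := integral_norm_sub_le_geometric hfi hq1 hinc₁ hg hlim j
  have hdist₂ (h : Euc d) (j : ℕ) : ∫ x, ‖(fwdDiff h)^[⌊a⌋₊ + 1] (g - f j) x‖ ≤
      C₂ * K * ‖h‖ ^ a * q ^ j / (1 - q) := by
    rw [fwdDiff_iter_sub]
    -- Differences are bounded on `L¹`, so `Δ_h^n (f j)` converges to `Δ_h^n g` for each fixed `h`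
    -- and the geometric tail passes to the limit.
    refine integral_norm_sub_le_geometric (fun j => (hfi j).fwdDiff_iter h _) hq1 (hinc₂ h)
      (hg.fwdDiff_iter h _) ?_ j
    refine squeeze_zero (fun j => integral_nonneg fun _ => norm_nonneg _) (fun j => ?_)
      (by simpa using hlim.const_mul (2 ^ (⌊a⌋₊ + 1)))
    rw [← fwdDiff_iter_sub]
    exact integral_norm_fwdDiff_iter_le ((hfi j).sub hg) h _
  have hbes (j : ℕ) : besovNorm a 1 (g - f j) ≤
      ENNReal.ofReal ((C₁ + C₂) * K / (1 - q) * q ^ j) := by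
    refine (besovNorm_one_le (hg.sub (hfi j)) (hdist₁ j)
      (B := C₂ * K * q ^ j / (1 - q)) (by positivity) fun h => ?_).trans
        (ENNReal.ofReal_le_ofReal (le_of_eq (by ring)))
    exact (hdist₂ h j).trans (le_of_eq (by ring))
  refine ⟨g, hg, fun φ => ?_, fun η hη => ?_, ?_⟩
  · have hφ (x : Euc d) : |φ x| ≤ ‖φ‖ := φ.norm_coe_le_norm x
    have hφi {u : Euc d → ℝ} (hu : Integrable u) : Integrable fun x => φ x * u x :=
      hu.bdd_mul φ.continuous.aestronglyMeasurable (.of_forall hφ)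
    have hl1 : Tendsto (fun j => ∫ x, φ x * f j x) atTop (𝓝 (∫ x, φ x * g x)) := by
      rw [tendsto_iff_norm_sub_tendsto_zero]
      refine squeeze_zero (fun _ => norm_nonneg _) (fun j => ?_)
        (by simpa using hlim.const_mul ‖φ‖)
      rw [← integral_sub (hφi (hfi j)) (hφi hg), ← integral_const_mul]
      refine norm_integral_le_of_norm_le (((hfi j).sub hg).norm.const_mul _)
        (.of_forall fun x => ?_)
      rw [← mul_sub, norm_mul]
      exact mul_le_mul_of_nonneg_right (hφ x) (norm_nonneg _)
    have hl2 : Tendsto (fun j => ∫ x, φ x * f j x) atTop (𝓝 (∫ x, φ x ∂μ)) := by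
      simp only [hf, integral_mul_mollify (htest _).integrable φ.continuous.measurable hφ]
      have hmeas (j : ℕ) : AEStronglyMeasurable (kernelAvg (doubleKernel d m (ε j)) φ) μ := by
        have : StronglyMeasurable (uncurry fun y u : Euc d =>
            doubleKernel d m (ε j) u * φ (y + u)) :=
          (((htest j).continuous.comp continuous_snd).mul
            (φ.continuous.comp (continuous_fst.add continuous_snd))).stronglyMeasurable
        exact this.integral_prod_right.aestronglyMeasurable
      refine tendsto_integral_of_dominated_convergence
        (fun _ => ‖φ‖ * (∫ x, ‖reprKernel d m x‖) * ∫ x, ‖reprKernel d m x‖) hmeas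
        (integrable_const _) (fun j => .of_forall fun y => ?_) (.of_forall fun y => ?_)
      · exact abs_kernelAvg_doubleKernel_le φ.continuous hφ (hε0 j) y
      · exact tendsto_kernelAvg_doubleKernel hm φ.continuous hφ hε0
          (tendsto_pow_atTop_nhds_zero_of_lt_one (by norm_num) (by norm_num)) y
    exact tendsto_nhds_unique hl1 hl2
  · have hq : Tendsto (fun j => ENNReal.ofReal ((C₁ + C₂) * K / (1 - q) * q ^ j)) atTop (𝓝 0) := by
      rw [← ENNReal.ofReal_zero]
      refine ENNReal.tendsto_ofReal ?_
      simpa using (tendsto_pow_atTop_nhds_zero_of_lt_one hq0.le hq1).const_mul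
        ((C₁ + C₂) * K / (1 - q))
    have hη2 : 0 < η / 2 := ENNReal.half_pos hη.ne'
    obtain ⟨j, hj⟩ := (hq.eventually_lt_const hη2).exists
    obtain ⟨ψ, hψ⟩ := (htest j).memBesov_mollify ha μ (η / 2) hη2
    refine ⟨ψ, ?_⟩
    have heq : (fun y => g y - ψ y) = (g - f j) + fun y => f j y - ψ y := by
      ext y
      simp
    rw [heq]
    refine (besovNorm_add_le (hg.sub (hfi j)).aestronglyMeasurable
      ((hfi j).aestronglyMeasurable.sub ψ.continuous.aestronglyMeasurable) a le_rfl).trans_lt ?_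
    calc _ < η / 2 + η / 2 := ENNReal.add_lt_add ((hbes j).trans_lt hj) hψ
      _ = η := ENNReal.add_halves η
  · have heq : g = (g - f 0) + f 0 := by simp
    rw [heq]
    refine (besovNorm_add_le (hg.sub (hfi 0)).aestronglyMeasurable
      (hfi 0).aestronglyMeasurable a le_rfl).trans ?_
    have h0 := h₀ μ
    have hf0 : f 0 = mollify (doubleKernel d m 1) μ := by simp [hf, hε]
    rw [← hf0] at h0
    refine (add_le_add (hbes 0) h0).trans ?_
    rw [← ENNReal.ofReal_add (by positivity) (by positivity)]
    refine ENNReal.ofReal_le_ofReal ?_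
    rw [probReal_univ, pow_zero]
    have : C₀ ≤ C₀ * K := le_mul_of_one_le_right hC₀ hK
    calc _ ≤ (C₁ + C₂) * K / (1 - q) * 1 + C₀ * K := by linarith
      _ = (C₀ + (C₁ + C₂) / (1 - q)) * K := by ring
      _ ≤ _ := mul_le_mul_of_nonneg_right (by linarith) hK0

/-- An integrable function representing a finite measure on bounded continuous functions is its
density. -/
lemma eq_withDensity_of_integral_eq {μ : Measure (Euc d)} [IsFiniteMeasure μ] {f : Euc d → ℝ}
    (hf : Integrable f)
    (h : ∀ φ : BoundedContinuousFunction (Euc d) ℝ, ∫ x, φ x * f x = ∫ x, φ x ∂μ) :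
    μ = volume.withDensity (fun x => ENNReal.ofReal (f x)) ∧ 0 ≤ᵐ[volume] f := by
  have hpos := isFiniteMeasure_withDensity_ofReal hf.2
  have hneg := isFiniteMeasure_withDensity_ofReal hf.neg.2
  have hint {u : Euc d → ℝ} (hu : Integrable u) (φ : BoundedContinuousFunction (Euc d) ℝ) :
      ∫ x, φ x ∂(volume.withDensity fun x => ENNReal.ofReal (u x)) =
        ∫ x, max (u x) 0 * φ x := by
    rw [integral_withDensity_eq_integral_toReal_smul₀ hu.1.aemeasurable.ennreal_ofReal
      (.of_forall fun x => ENNReal.ofReal_lt_top)]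
    rfl
  -- Written as `μ + f⁻ dx = f⁺ dx`, the hypothesis equates finite positive measures, which bounded
  -- continuous functions determine. Then `f⁻ ≤ f⁺` almost everywhere, which forces `f⁻ = 0`.
  have heq : μ + volume.withDensity (fun x => ENNReal.ofReal ((-f) x)) =
      volume.withDensity fun x => ENNReal.ofReal (f x) := by
    refine ext_of_forall_integral_eq_of_IsFiniteMeasure fun φ => ?_
    have hφi {u : Euc d → ℝ} (hu : Integrable u) : Integrable fun x => max (u x) 0 * φ x :=
      hu.pos_part.mul_bdd φ.continuous.aestronglyMeasurable
        (.of_forall fun x => φ.norm_coe_le_norm x)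
    rw [integral_add_measure (φ.integrable μ) (φ.integrable _), hint hf, hint hf.neg, ← h φ,
      ← eq_sub_iff_add_eq, ← integral_sub (hφi hf) (hφi hf.neg)]
    congr 1
    ext x
    have : f x = max (f x) 0 - max (-f x) 0 := by
      rcases le_total 0 (f x) with h | h <;> simp [h]
    rw [Pi.neg_apply, ← sub_mul, ← this, mul_comm]
  have hnonneg : 0 ≤ᵐ[volume] f := by
    have hle : (fun x => ENNReal.ofReal ((-f) x)) ≤ᵐ[volume] fun x => ENNReal.ofReal (f x) := by
      refine ae_le_of_forall_setLIntegral_le_of_sigmaFinite₀ hf.neg.1.aemeasurable.ennreal_ofReal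
        fun s hs _ => ?_
      rw [← withDensity_apply _ hs, ← withDensity_apply _ hs, ← heq, Measure.add_apply]
      exact le_add_self
    filter_upwards [hle] with x hx
    by_contra hlt
    have hlt' : f x < 0 := not_le.1 hlt
    rw [ENNReal.ofReal_of_nonpos hlt'.le, nonpos_iff_eq_zero, ENNReal.ofReal_eq_zero,
      Pi.neg_apply] at hx
    linarith
  refine ⟨?_, hnonneg⟩
  have hzero : volume.withDensity (fun x => ENNReal.ofReal ((-f) x)) = 0 := by
    rw [withDensity_congr_ae (g := 0), withDensity_zero]
    filter_upwards [hnonneg] with x hx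
    simpa using hx
  rwa [hzero, add_zero] at heq

/-! ### Smoothing bounds from the two-parameter estimate -/

lemma IsTestFun.memZygmund {g : Euc d → ℝ} (hg : IsTestFun g) (α : ℝ) : MemZygmund α g := by
  refine ⟨hg.continuous, fun η hη => ⟨hg.compact.toSchwartzMap hg.smooth, ?_⟩⟩
  have h0 : (fun y => g y - hg.compact.toSchwartzMap hg.smooth y) = fun _ => 0 := by
    ext y
    simp
  rw [h0, besovNorm, besovSeminorm]
  simpa only [fwdDiff_iter_zero_fun, eLpNorm_zero', ENNReal.zero_div, ENNReal.iSup_zero, add_zero]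
    using hη

lemma toReal_besovNorm_top_le {g : Euc d → ℝ} {α M : ℝ} (hα1 : α < 1)
    (hM : ∀ y, |g y| ≤ M) (hMα : ∀ k y, |fwdDiff k g y| ≤ M * ‖k‖ ^ α) :
    (besovNorm α ⊤ g).toReal ≤ 2 * M := by
  have hM0 : 0 ≤ M := (abs_nonneg _).trans (hM 0)
  refine ENNReal.toReal_le_of_le_ofReal (by positivity) ?_
  rw [two_mul, ENNReal.ofReal_add hM0 hM0, besovNorm]
  refine add_le_add ?_ (iSup₂_le fun k hk => ?_)
  · rw [eLpNorm_exponent_top]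
    exact eLpNormEssSup_le_of_ae_bound (.of_forall hM)
  · rw [Nat.floor_eq_zero.2 hα1, zero_add, iterate_one, eLpNorm_exponent_top]
    refine ENNReal.div_le_of_le_mul ?_
    rw [← ENNReal.ofReal_mul hM0]
    exact eLpNormEssSup_le_of_ae_bound (.of_forall (hMα k))

lemma fwdDiff_iter_neg (g : Euc d → ℝ) (h : Euc d) (n : ℕ) :
    (fwdDiff h)^[n] (-g) = -(fwdDiff h)^[n] g := by
  have := fwdDiff_iter_const_smul h (-1 : ℝ) g n
  simpa using this

/-- With `ε` comparable to `‖h‖^(γθ)` the first term of the estimate becomes `‖h‖^s` and the second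
`‖h‖^(m(1-γ))`, which `hs` makes no larger. This choice is admissible only for `‖h‖^(γθ) ≤ 1 ∧ t`;
for larger `h` the trivial bound `2^m M` suffices, at the price of the negative power of `1 ∧ t`. -/
lemma smoothingBound_of_forall_le {μ : Measure (Euc d)} [IsProbabilityMeasure μ] {m : ℕ}
    {a₀ θ α γ t K₀ : ℝ} (hm : m ≠ 0) (ha₀ : 0 < a₀) (hθ : 0 < θ) (hα : 0 < α) (hα1 : α < 1)
    (hγ : 0 < γ) (hs : γ * (α * (1 + a₀)) ≤ m * (1 - γ)) (ht : 0 < t) (hK₀ : 1 ≤ K₀)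
    (H : ∀ ε : ℝ, 0 < ε → ε < 1 → ε ≤ t / 2 → ∀ φ : Euc d → ℝ, MemZygmund α φ →
      ∀ h : Euc d, ‖h‖ ≤ 1 → ∫ y, (fwdDiff h)^[m] φ y ∂μ ≤
        K₀ ^ (α / θ) * (ε ^ (α / θ * (1 + a₀)) + (‖h‖ / ε ^ (1 / θ)) ^ m) *
          (besovNorm α ⊤ φ).toReal) :
    SmoothingBound μ m α (γ * (α * (1 + a₀)))
      ((2 * (1 + (4 ^ (1 / θ)) ^ m) + 2 ^ m) * K₀ ^ (α / θ) *
        min 1 t ^ (-(α / θ * (1 + a₀)))) := by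
  set T : ℝ := min 1 t with hT
  have hT0 : 0 < T := lt_min one_pos ht
  have hT1 : T ≤ 1 := min_le_left _ _
  have hTt : T ≤ t := min_le_right _ _
  set e : ℝ := α / θ * (1 + a₀) with he
  have he0 : 0 < e := by positivity
  have hγe : γ * θ * e = γ * (α * (1 + a₀)) := by
    rw [he]; field_simp
  set s : ℝ := γ * (α * (1 + a₀)) with hsdef
  have hs0 : 0 < s := by positivity
  have hKα : 1 ≤ K₀ ^ (α / θ) := Real.one_le_rpow hK₀ (by positivity)
  have hTe : 1 ≤ T ^ (-e) := Real.one_le_rpow_of_pos_of_le_one_of_nonpos hT0 hT1 (by linarith)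
  set D : ℝ := (4 ^ (1 / θ)) ^ m with hD
  have hD0 : 0 ≤ D := by positivity
  have key (g : Euc d → ℝ) (hg : IsTestFun g) (M : ℝ) (hM : ∀ y, |g y| ≤ M)
      (hMα : ∀ k y, |fwdDiff k g y| ≤ M * ‖k‖ ^ α) (h : Euc d) (hh : ‖h‖ ≤ 1) :
      ∫ y, (fwdDiff h)^[m] g y ∂μ ≤
        (2 * (1 + D) + 2 ^ m) * K₀ ^ (α / θ) * T ^ (-e) * ‖h‖ ^ s * M := by
    have hM0 : 0 ≤ M := (abs_nonneg _).trans (hM 0)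
    rcases eq_or_ne h 0 with rfl | hh0
    · obtain ⟨k, rfl⟩ := Nat.exists_eq_succ_of_ne_zero hm
      have h0 : (fwdDiff (0 : Euc d))^[k.succ] g = fun _ => 0 := by
        rw [iterate_succ_apply']
        ext y
        simp [fwdDiff]
      rw [h0, integral_zero]
      positivity
    have hn : 0 < ‖h‖ := norm_pos_iff.2 hh0
    rcases le_or_gt (‖h‖ ^ (γ * θ)) T with hcase | hcase
    -- Division by 4 ensures both `ε < 1` and `ε ≤ t / 2`; it is paid for by the factor `D`.
    · set ε : ℝ := ‖h‖ ^ (γ * θ) / 4 with hε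
      have hp : 0 < ‖h‖ ^ (γ * θ) := by positivity
      have h1 := H ε (by positivity) (by linarith) (by linarith) g (hg.memZygmund α) h hh
      have h2 : ε ^ e ≤ ‖h‖ ^ s := by
        calc ε ^ e ≤ (‖h‖ ^ (γ * θ)) ^ e :=
              Real.rpow_le_rpow (by positivity) (by linarith) he0.le
          _ = ‖h‖ ^ s := by rw [← Real.rpow_mul hn.le, hγe]
      have h3 : (‖h‖ / ε ^ (1 / θ)) ^ m ≤ D * ‖h‖ ^ s := by
        have h4 : ε ^ (1 / θ) = ‖h‖ ^ γ / 4 ^ (1 / θ) := by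
          rw [hε, Real.div_rpow hp.le (by norm_num), ← Real.rpow_mul hn.le]
          congr 2
          field_simp
        have h5 : ‖h‖ / ε ^ (1 / θ) = 4 ^ (1 / θ) * ‖h‖ ^ (1 - γ) := by
          rw [h4, Real.rpow_sub hn, Real.rpow_one]
          field_simp
        rw [h5, mul_pow, ← Real.rpow_mul_natCast hn.le]
        refine mul_le_mul_of_nonneg_left ?_ hD0
        exact Real.rpow_le_rpow_of_exponent_ge hn hh (by linarith)
      calc _ ≤ _ := h1
        _ ≤ K₀ ^ (α / θ) * (‖h‖ ^ s + D * ‖h‖ ^ s) * (2 * M) := by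
            gcongr
            exact toReal_besovNorm_top_le hα1 hM hMα
        _ = (2 * (1 + D)) * K₀ ^ (α / θ) * 1 * ‖h‖ ^ s * M := by ring
        _ ≤ _ := by
            gcongr
            linarith [pow_pos (two_pos : (0 : ℝ) < 2) m]
    · have h1 : 1 ≤ T ^ (-e) * ‖h‖ ^ s := by
        have h2 : T ^ e ≤ ‖h‖ ^ s := by
          rw [← hγe, Real.rpow_mul hn.le]
          exact Real.rpow_le_rpow hT0.le hcase.le he0.le
        calc (1 : ℝ) = T ^ (-e) * T ^ e := by rw [← Real.rpow_add hT0]; simp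
          _ ≤ _ := by gcongr
      have h3 : ∫ y, (fwdDiff h)^[m] g y ∂μ ≤ 2 ^ m * M := by
        refine (le_abs_self _).trans ?_
        have := norm_integral_le_of_norm_le_const (μ := μ) (C := 2 ^ m * M)
          (f := (fwdDiff h)^[m] g)
          (.of_forall fun y => abs_fwdDiff_iter_le hM h m y)
        simpa using this
      calc _ ≤ 2 ^ m * M := h3
        _ = 2 ^ m * 1 * 1 * M := by ring
        _ ≤ (2 * (1 + D) + 2 ^ m) * K₀ ^ (α / θ) * (T ^ (-e) * ‖h‖ ^ s) * M := by
            gcongr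
            linarith
        _ = _ := by ring
  intro g hg M hM hMα h hh
  refine abs_le'.2 ⟨key g hg M hM hMα h hh, ?_⟩
  -- The given estimate is one-sided; applying it to `-g` yields the absolute value.
  have hneg := key (-g) (by simpa using hg.const_smul (-1)) M (by simpa using hM) (fun k y => by
    have h1 := fwdDiff_iter_neg g k 1
    simp only [iterate_one] at h1
    rw [h1, Pi.neg_apply, abs_neg]
    exact hMα k y) h hh
  rw [fwdDiff_iter_neg] at hneg
  simpa [integral_neg] using hneg

end

/-! ### Choice of the exponents and conclusion. -/

theorem propositionp (d : ℕ) (a₀ θ a δ : ℝ) (ha₀ : 0 < a₀) (hθ : 0 < θ)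
    (ha : 0 < a) (haa₀ : a < a₀) (hδ : 0 < δ) :
    ∃ m₀ : ℕ, ∀ m : ℕ, m₀ ≤ m → ∃ c : ℝ, 0 < c ∧
      ∀ (d' : ℕ) (β : ℝ) (b : Euc d → Euc d) (σ : Euc d → Matrix (Fin d) (Fin d') ℝ),
        0 < β → β < 1 → MemLp b ⊤ volume → IsBoundedHolder β σ →
      ∀ (Ω : Type*) (mΩ : MeasurableSpace Ω) (P : Measure Ω) (_ : IsProbabilityMeasure P)
        (ℱ : Filtration ℝ≥0 mΩ) (B : ℝ≥0 → Ω → Euc d') (X : ℝ≥0 → Ω → Euc d) (x : Euc d),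
        IsSDESolution b σ x ℱ P B X →
      ∀ (t : ℝ≥0) (K₀ : ℝ), 0 < t → 1 ≤ K₀ →
        (∀ ε : ℝ, 0 < ε → ε < 1 → ε ≤ (t : ℝ) / 2 →
          ∀ α : ℝ, 0 < α → α < 1 →
          ∀ φ : Euc d → ℝ, MemZygmund α φ →
          ∀ h : Euc d, ‖h‖ ≤ 1 →
            ∫ ω, ((fwdDiff h)^[m] φ) (X t ω) ∂P ≤
              K₀ ^ (α / θ) * (ε ^ (α / θ * (1 + a₀)) + (‖h‖ / ε ^ (1 / θ)) ^ m) *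
                (besovNorm α ⊤ φ).toReal) →
        HasPDF (X t) P volume ∧
        MemBesov a 1 (fun y => (pdf (X t) P volume y).toReal) ∧
        besovNorm a 1 (fun y => (pdf (X t) P volume y).toReal) ≤
          ENNReal.ofReal (c * K₀ ^ (a / (θ * a₀) + δ) *
            (min 1 (t : ℝ)) ^ (-((1 + a₀) / (θ * a₀) * a) - δ)) := by
  -- The lower bound gives `α a₀ > a`; the upper one keeps the exponents of `K₀` and `1 ∧ t` within
  -- `δ` of their values at `a / a₀`.
  obtain ⟨α, hα_gt, hα_lt⟩ : ∃ α, a / a₀ < α ∧ α < min 1 (a / a₀ + δ * θ / (1 + a₀)) :=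
    exists_between (lt_min ((div_lt_one ha₀).2 haa₀) (lt_add_of_pos_right _ (by positivity)))
  have hα : 0 < α := lt_trans (by positivity) hα_gt
  have hα1 : α < 1 := hα_lt.trans_le (min_le_left _ _)
  have hαδ : α < a / a₀ + δ * θ / (1 + a₀) := hα_lt.trans_le (min_le_right _ _)
  have haα : a < α * a₀ := (div_lt_iff₀ ha₀).1 hα_gt
  -- Since `α + a < α (1 + a₀)`, some `γ < 1` still leaves `s = γ α (1 + a₀)` above `α + a`, and `1
  -- - γ > 0` allows a large `m` to absorb the second term.
  obtain ⟨γ, hγ_gt, hγ1⟩ : ∃ γ, (α + a) / (α * (1 + a₀)) < γ ∧ γ < 1 :=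
    exists_between ((div_lt_one (by positivity)).2 (by linarith))
  have hγ : 0 < γ := lt_trans (by positivity) hγ_gt
  have hs : α + a < γ * (α * (1 + a₀)) := (div_lt_iff₀ (by positivity)).1 hγ_gt
  have hexpT : α / θ * (1 + a₀) ≤ (1 + a₀) / (θ * a₀) * a + δ := by
    calc α / θ * (1 + a₀) ≤ (a / a₀ + δ * θ / (1 + a₀)) / θ * (1 + a₀) := by gcongr
      _ = _ := by field_simp
  have hexpK : α / θ ≤ a / (θ * a₀) + δ := by
    have h1 : δ * θ / (1 + a₀) ≤ δ * θ := div_le_self (by positivity) (by linarith)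
    calc α / θ ≤ (a / a₀ + δ * θ) / θ := by gcongr; linarith
      _ = _ := by field_simp
  -- The ceiling gives `s ≤ m (1 - γ)`, and the added 1 gives `m ≠ 0`.
  refine ⟨⌈γ * (α * (1 + a₀)) / (1 - γ)⌉₊ + 1, fun m hm => ?_⟩
  have hm0 : m ≠ 0 := by omega
  have hsm : γ * (α * (1 + a₀)) ≤ m * (1 - γ) := by
    rw [← div_le_iff₀ (by linarith)]
    refine (Nat.le_ceil _).trans ?_
    exact_mod_cast (Nat.le_succ _).trans hm
  obtain ⟨C, hC, hdens⟩ := exists_density_of_smoothingBound d hm0 hα.le hα1.le ha.le hs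
  set D : ℝ := 2 * (1 + (4 ^ (1 / θ)) ^ m) + 2 ^ m with hD
  have hD1 : 1 ≤ D := by
    have h1 : (0 : ℝ) ≤ (4 ^ (1 / θ)) ^ m := by positivity
    have h2 : (0 : ℝ) ≤ 2 ^ m := by positivity
    linarith
  refine ⟨C * D, by positivity, ?_⟩
  intro d' β b σ _ _ _ _ Ω mΩ P _ ℱ B X x hX t K₀ ht hK₀ H
  have hXm : Measurable (X t) := (hX.adapted t).mono (ℱ.le t) le_rfl
  have ht' : (0 : ℝ) < t := ht
  set T : ℝ := min 1 (t : ℝ) with hT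
  have hT0 : 0 < T := lt_min one_pos ht'
  have hT1 : T ≤ 1 := min_le_left _ _
  have : IsProbabilityMeasure (P.map (X t)) := Measure.isProbabilityMeasure_map hXm.aemeasurable
  have hsmooth : SmoothingBound (P.map (X t)) m α (γ * (α * (1 + a₀)))
      (D * K₀ ^ (α / θ) * T ^ (-(α / θ * (1 + a₀)))) := by
    refine smoothingBound_of_forall_le hm0 ha₀ hθ hα hα1 hγ hsm ht' hK₀
      fun ε hε hε1 hεt φ hφ h hh => ?_
    rw [integral_map hXm.aemeasurable]
    · exact H ε hε hε1 hεt α hα hα1 φ hφ h hh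
    · have hc : Continuous ((fwdDiff h)^[m] φ) := by
        have : ∀ n, Continuous ((fwdDiff h)^[n] φ) := fun n => by
          induction n with
          | zero => exact hφ.1
          | succ n ih =>
            rw [Function.iterate_succ_apply']
            exact (ih.comp (continuous_add_const h)).sub ih
        exact this m
      exact hc.aestronglyMeasurable
  have hKα : 1 ≤ K₀ ^ (α / θ) := Real.one_le_rpow hK₀ (by positivity)
  have hTe : 1 ≤ T ^ (-(α / θ * (1 + a₀))) :=
    Real.one_le_rpow_of_pos_of_le_one_of_nonpos hT0 hT1 (neg_nonpos.2 (by positivity))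
  obtain ⟨f, hf, hfμ, hfB, hfN⟩ := hdens (P.map (X t)) _
    (one_le_mul_of_one_le_of_one_le (one_le_mul_of_one_le_of_one_le hD1 hKα) hTe) hsmooth
  obtain ⟨hμ, hf0⟩ := eq_withDensity_of_integral_eq hf hfμ
  have hpdf : HasPDF (X t) P volume :=
    hasPDF_of_map_eq_withDensity hXm.aemeasurable _ hf.1.aemeasurable.ennreal_ofReal hμ
  have hae : (fun y => (pdf (X t) P volume y).toReal) =ᵐ[volume] f := by
    filter_upwards [(pdf.eq_of_map_eq_withDensity _ hf.1.aemeasurable.ennreal_ofReal).1 hμ, hf0]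
      with y hy hy0
    rw [hy, ENNReal.toReal_ofReal hy0]
  refine ⟨hpdf, fun η hη => ?_, ?_⟩
  · obtain ⟨g, hg⟩ := hfB η hη
    refine ⟨g, lt_of_eq_of_lt (besovNorm_congr_ae ?_ a 1) hg⟩
    filter_upwards [hae] with y hy
    rw [hy]
  · rw [besovNorm_congr_ae hae]
    refine hfN.trans (ENNReal.ofReal_le_ofReal ?_)
    calc C * (D * K₀ ^ (α / θ) * T ^ (-(α / θ * (1 + a₀))))
        = C * D * K₀ ^ (α / θ) * T ^ (-(α / θ * (1 + a₀))) := by ring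
      _ ≤ _ := mul_le_mul
        (mul_le_mul_of_nonneg_left (Real.rpow_le_rpow_of_exponent_le hK₀ hexpK) (by positivity))
        (Real.rpow_le_rpow_of_exponent_ge hT0 hT1 (by linarith)) (by positivity) (by positivity)
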